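/- Consider the measurement model $\mathbf y=\mathbf\Phi\mathbf x+\mathbf n$ with $\mathbf\Phi\in\mathbb R^{M\times N}$ and $\mathbf n\sim\mathcal N(\mathbf 0,\sigma^2\mathbf I)$ independent of the source. The class $C\in\{1,\dots,L\}$ is drawn with probabilities $p_1,\dots,p_L$, and given $C=i$ the source is $\mathbf x\sim\mathcal N(\mathbf 0,\mathbf\Sigma_i)$. The images $\mathcal R_i=\mathrm{Im}(\mathbf\Sigma_i)$ all have the same dimension $r_{\mathbf\Sigma}<N$ and are drawn independently from distributions that have a density with respect to the uniform measure on the Grassmann manifold of $r_{\mathbf\Sigma}$-dimensional subspaces of $\mathbb R^N$. Let $P_e=P_e(\sigma^2,\mathbf\Phi)$ be the misclassification probability of the maximum a posteriori classifier, which knows $p_i,\mathbf\Sigma_i,\mathbf\Phi,\sigma^2$ and chooses $\arg\max_i p_i\,p(\mathbf y\mid C=i)$. Put $R=2\min\{N-r_{\mathbf\Sigma},r_{\mathbf\Sigma}\}$ and let $d_0<R/4$. Consider the integer program $$ \begin{aligned} \underset{(M_1,\ldots,M_L)\in\mathbb N^L}{\text{minimize}}\quad & M=\sum_{i=1}^L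 M_i\\ \text{subject to}\quad & M_i\le N-r_{\mathbf\Sigma}\quad\forall i,\\ & f(M,M_i,M_j)-2(M-2r_{\mathbf\Sigma})>4d_0\quad\forall i\ne j,\\ & f(M,M_i,M_j)-2(M_i-r_{\mathbf\Sigma})>4d_0\quad\forall i\ne j,\\ & f(M,M_i,M_j)-2(M_j-r_{\mathbf\Sigma})>4d_0\quad\forall i\ne j,\\ & f(M,M_i,M_j)>4d_0\quad\forall i\ne j, \end{aligned} $$ where $f(M,M_i,M_j)=\max\{M-r_{\mathbf\Sigma},M_i\}+\max\{M-r_{\mathbf\Sigma},M_j\}$. With probability one over the draw of $\mathcal R_1,\dots,\mathcal R_L$, for all covariance matrices $\mathbf\Sigma_i$ with these images: the program has an optimal value; there is a minimum number $M$ of measurements for which some (designed) matrix $\mathbf\Phi\in\mathbb R^{M\times N}$ satisfies $$\lim_{\sigma^2\to0}-\frac{\log P_e}{\log(1/\sigma^2)}>d_0$$ (the limit existing in $[-\infty,\infty]$, with $\log 0=-\infty$); and this minimum number is at most the optimal value of the program. -/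

import Mathlib

open MeasureTheory ProbabilityTheory Filter Topology
open scoped ENNReal

noncomputable section

namespace LinearClassification

/-! ### Random subspaces -/

/-- The Grassmannian of `r`-dimensional linear subspaces of `ℝᴺ`. -/
def Grassmannian (N r : ℕ) : Type :=
  {V : Submodule ℝ (EuclideanSpace ℝ (Fin N)) // Module.finrank ℝ V = r}

/-- The matrix of the orthogonal projection of `ℝᴺ` onto the subspace `V`. -/
def Grassmannian.proj {N r : ℕ} (V : Grassmannian N r) : Fin N → Fin N → ℝ :=
  fun i j => V.1.starProjection (EuclideanSpace.single j 1) i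

/-- The Borel σ-algebra of the Grassmannian, with a subspace identified with its orthogonal
projection (the usual embedding of the Grassmannian into the space of symmetric matrices). -/
instance (N r : ℕ) : MeasurableSpace (Grassmannian N r) :=
  MeasurableSpace.comap Grassmannian.proj inferInstance

/-- The linear span of `r` linearly independent vectors of `ℝᴺ`. -/
def frameSpan (N r : ℕ)
    (a : {a : Fin r → EuclideanSpace ℝ (Fin N) // LinearIndependent ℝ a}) : Grassmannian N r :=
  ⟨Submodule.span ℝ (Set.range a.1), by simpa using finrank_span_eq_card a.2⟩

/-- The uniform (rotation invariant) probability measure on the Grassmannian, for `r ≤ N`: the law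
of the span of `r` independent standard Gaussian vectors of `ℝᴺ` (which are linearly independent
almost surely). -/
def uniformGrassmann (N r : ℕ) : Measure (Grassmannian N r) :=
  ((Measure.pi fun _ : Fin r => stdGaussian (EuclideanSpace ℝ (Fin N))).comap
    (Subtype.val : {a : Fin r → EuclideanSpace ℝ (Fin N) // LinearIndependent ℝ a} → _)).map
    (frameSpan N r)

/-- The span is a measurable function of the frame, so that the push-forward measure
`uniformGrassmann` is the intended one. -/
theorem measurable_frameSpan (N r : ℕ) : Measurable (frameSpan N r) := by
  refine measurable_comap_iff.2 ?_
  have key : ∀ (a : {a : Fin r → EuclideanSpace ℝ (Fin N) // LinearIndependent ℝ a}) (i j : Fin N),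
      (frameSpan N r a).proj i j =
        ∑ k, (∑ l, (Matrix.gram ℝ a.1).adjugate k l * (a.1 l).ofLp j) /
          (Matrix.gram ℝ a.1).det * (a.1 k).ofLp i := by
    intro a i j
    have hdet : (Matrix.gram ℝ a.1).det ≠ 0 :=
      Matrix.det_gram_ne_zero_iff_linearIndependent.2 a.2
    have h := Submodule.eq_starProjection_of_mem_of_inner_eq_zero
      (K := (frameSpan N r a).1) (u := EuclideanSpace.single j (1 : ℝ))
      (v := ∑ k, ((∑ l, (Matrix.gram ℝ a.1).adjugate k l * (a.1 l).ofLp j) /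
          (Matrix.gram ℝ a.1).det) • a.1 k)
      (Submodule.sum_mem _ fun k _ => Submodule.smul_mem _ _
        (Submodule.subset_span (Set.mem_range_self k))) ?_
    · simp only [Grassmannian.proj]
      rw [h]
      simp
    · intro w hw
      induction hw using Submodule.span_induction with
      | mem x hx =>
        obtain ⟨m, rfl⟩ := hx
        have h2 := congrFun (congrArg (fun A => A.mulVec fun l => (a.1 l).ofLp j)
          (Matrix.mul_adjugate (Matrix.gram ℝ a.1))) m
        rw [← Matrix.mulVec_mulVec, Matrix.smul_mulVec, Matrix.one_mulVec] at h2
        have h3 : ∑ k, ((∑ l, (Matrix.gram ℝ a.1).adjugate k l * (a.1 l).ofLp j) /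
          (Matrix.gram ℝ a.1).det) * inner ℝ (a.1 k) (a.1 m) = (a.1 m).ofLp j := by
          rw [eq_comm, ← mul_right_inj' hdet]
          simp only [Pi.smul_apply, smul_eq_mul] at h2
          rw [← h2, Finset.mul_sum]
          simp only [Matrix.mulVec, dotProduct, Matrix.gram_apply]
          refine Finset.sum_congr rfl fun k _ => ?_
          rw [real_inner_comm (a.1 m)]
          field_simp
        rw [inner_sub_left, sum_inner]
        simp only [inner_smul_left]
        simp only [conj_trivial]
        rw [h3]
        simp [EuclideanSpace.inner_single_left]
      | zero => simp
      | add x y _ _ hx hy => rw [inner_add_right, hx, hy, add_zero]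
      | smul c x _ hx => rw [inner_smul_right, hx, mul_zero]
  refine measurable_pi_lambda _ fun i => measurable_pi_lambda _ fun j => ?_
  simp only [Function.comp_def, key]
  have hv : ∀ k, Continuous
      fun a : {a : Fin r → EuclideanSpace ℝ (Fin N) // LinearIndependent ℝ a} => a.1 k :=
    fun k => (continuous_apply k).comp continuous_subtype_val
  have hc : ∀ k i, Measurable
      fun a : {a : Fin r → EuclideanSpace ℝ (Fin N) // LinearIndependent ℝ a} => (a.1 k).ofLp i :=
    fun k i => ((EuclideanSpace.proj (𝕜 := ℝ) i).continuous.comp (hv k)).measurable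
  have hg : Continuous fun a : {a : Fin r → EuclideanSpace ℝ (Fin N) // LinearIndependent ℝ a} =>
      Matrix.gram ℝ a.1 :=
    continuous_matrix fun k l => (hv k).inner (hv l)
  refine Finset.measurable_fun_sum _ fun k _ => ?_
  refine Measurable.mul (Measurable.div ?_ hg.matrix_det.measurable) (hc k i)
  refine Finset.measurable_fun_sum _ fun l _ => ?_
  exact Measurable.mul (hg.matrix_adjugate.matrix_elem k l).measurable (hc l j)

/-! ### The measurement model, the MAP classifier and its error probability -/

/-- The law of `y = Φ x + n` given a class with covariance matrix `S`: here `x ∼ 𝒩(0, S)` and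
`n ∼ 𝒩(0, v I)` are independent, `v` being the noise variance `σ²`. -/
def measurementLaw {M N : ℕ} (Φ : Matrix (Fin M) (Fin N) ℝ) (S : Matrix (Fin N) (Fin N) ℝ)
    (v : ℝ) : Measure (EuclideanSpace ℝ (Fin M)) :=
  ((multivariateGaussian (0 : EuclideanSpace ℝ (Fin N)) S).prod
    (multivariateGaussian (0 : EuclideanSpace ℝ (Fin M)) (v • 1))).map
    fun q => Φ.toEuclideanLin q.1 + q.2

/-- The density of the centred Gaussian law on `ℝᴹ` with (positive definite) covariance `K`. -/
def gaussianDensity {M : ℕ} (K : Matrix (Fin M) (Fin M) ℝ) (y : EuclideanSpace ℝ (Fin M)) : ℝ :=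
  (Real.sqrt ((2 * Real.pi) ^ M * K.det))⁻¹ *
    Real.exp (-(1 / 2) * (y.ofLp ⬝ᵥ (K⁻¹).mulVec y.ofLp))

/-- The density `p(y | C = i)` of the measurement given a class with covariance matrix `S`. -/
def classDensity {M N : ℕ} (Φ : Matrix (Fin M) (Fin N) ℝ) (S : Matrix (Fin N) (Fin N) ℝ)
    (v : ℝ) (y : EuclideanSpace ℝ (Fin M)) : ℝ :=
  gaussianDensity (Φ * S * Φ.transpose + v • (1 : Matrix (Fin M) (Fin M) ℝ)) y

/-- `c` is a maximum a posteriori classifier: `c y` maximises `p_i p(y | C = i)` over the classes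
`i`, ties being broken in any measurable way. -/
def IsMAP {L M N : ℕ} (p : Fin L → ℝ) (S : Fin L → Matrix (Fin N) (Fin N) ℝ)
    (Φ : Matrix (Fin M) (Fin N) ℝ) (v : ℝ) (c : EuclideanSpace ℝ (Fin M) → Fin L) : Prop :=
  Measurable c ∧ ∀ y i, p i * classDensity Φ (S i) v y ≤ p (c y) * classDensity Φ (S (c y)) v y

/-- A MAP classifier exists as soon as there is a class. -/
theorem exists_isMAP {L M N : ℕ} (hL : 0 < L) (p : Fin L → ℝ)
    (S : Fin L → Matrix (Fin N) (Fin N) ℝ) (Φ : Matrix (Fin M) (Fin N) ℝ) (v : ℝ) :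
    ∃ c, IsMAP p S Φ v c := by
  classical
  have : Nonempty (Fin L) := ⟨⟨0, hL⟩⟩
  set g : Fin L → EuclideanSpace ℝ (Fin M) → ℝ := fun i y => p i * classDensity Φ (S i) v y with hg
  have hgm : ∀ i, Measurable (g i) := fun i => by
    refine Continuous.measurable ?_
    simp only [hg, classDensity, gaussianDensity, Matrix.mulVec, dotProduct]
    fun_prop
  have hex : ∀ y, ∃ i, ∀ j, g j y ≤ g i y := fun y => Finite.exists_max fun i => g i y
  have hne : ∀ y, (Finset.univ.filter fun i => ∀ j, g j y ≤ g i y).Nonempty := fun y => by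
    obtain ⟨i, hi⟩ := hex y
    exact ⟨i, by simpa using hi⟩
  have hset : ∀ i, MeasurableSet {y | ∀ j, g j y ≤ g i y} := fun i => by
    rw [Set.ofPred_forall]
    exact MeasurableSet.iInter fun j => measurableSet_le (hgm j) (hgm i)
  refine ⟨fun y => (Finset.univ.filter fun i => ∀ j, g j y ≤ g i y).min' (hne y), ?_, ?_⟩
  · refine measurable_to_countable' fun i => ?_
    have : (fun y => (Finset.univ.filter fun i => ∀ j, g j y ≤ g i y).min' (hne y)) ⁻¹' {i} =
        {y | ∀ j, g j y ≤ g i y} ∩ ⋂ k : Fin L, ⋂ _ : k < i, {y | ∀ j, g j y ≤ g k y}ᶜ := by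
      ext y
      simp only [Set.mem_preimage, Set.mem_singleton_iff, Set.mem_inter_iff, Set.mem_iInter,
        Finset.min'_eq_iff, Finset.mem_filter, Finset.mem_univ, true_and, Set.mem_compl_iff,
        Set.mem_ofPred_eq]
      refine and_congr_right fun _ => ⟨fun h k hk hh => ?_, fun h k hk => ?_⟩
      · exact absurd (h k hh) (not_le.2 hk)
      · by_contra hlt
        exact h k (not_le.1 hlt) hk
    rw [this]
    exact (hset i).inter (MeasurableSet.iInter fun k => MeasurableSet.iInter fun _ => (hset k).compl)
  · intro y i
    have := Finset.min'_mem _ (hne y)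
    exact (Finset.mem_filter.1 this).2 i

/-- The misclassification probability `∑ᵢ pᵢ ℙ[c(y) ≠ i | C = i]` of the classifier `c`. -/
def errorProb {L M N : ℕ} (p : Fin L → ℝ) (S : Fin L → Matrix (Fin N) (Fin N) ℝ)
    (Φ : Matrix (Fin M) (Fin N) ℝ) (v : ℝ) (c : EuclideanSpace ℝ (Fin M) → Fin L) : ℝ≥0∞ :=
  ∑ i, ENNReal.ofReal (p i) * measurementLaw Φ (S i) v {y | c y ≠ i}

/-- `lim_{σ² → 0} - log P_e / log (1 / σ²) > d₀` for the measurement matrix `Φ`, where `P_e` is the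
misclassification probability of the MAP classifier: the limit exists in the extended reals
(`log 0 = -∞`) and is greater than `d₀`. -/
def DecayExponentGT {L M N : ℕ} (p : Fin L → ℝ) (S : Fin L → Matrix (Fin N) (Fin N) ℝ)
    (Φ : Matrix (Fin M) (Fin N) ℝ) (d₀ : ℝ) : Prop :=
  ∀ c : ℝ → EuclideanSpace ℝ (Fin M) → Fin L, (∀ v, 0 < v → IsMAP p S Φ v (c v)) →
    ∃ l : EReal,
      Tendsto (fun v : ℝ =>
          -(errorProb p S Φ v (c v)).log / ((Real.log (1 / v) : ℝ) : EReal)) (𝓝[>] 0) (𝓝 l) ∧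
        (d₀ : EReal) < l

/-! ### The integer program -/

/-- `f(M, a, b) = max {M - r, a} + max {M - r, b}`. -/
def programF (r M a b : ℤ) : ℤ := max (M - r) a + max (M - r) b

/-- The constraints of the integer program on `(M₁, …, M_L) ∈ ℕᴸ`, with `M = M₁ + ⋯ + M_L`. -/
def IsFeasible (L N r : ℕ) (d₀ : ℝ) (m : Fin L → ℕ) : Prop :=
  (∀ i, (m i : ℤ) ≤ N - r) ∧
    ∀ i j, i ≠ j →
      ((programF r (∑ k, m k : ℕ) (m i) (m j) - 2 * ((∑ k, m k : ℕ) - 2 * r) : ℤ) : ℝ) > 4 * d₀ ∧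
      ((programF r (∑ k, m k : ℕ) (m i) (m j) - 2 * (m i - r) : ℤ) : ℝ) > 4 * d₀ ∧
      ((programF r (∑ k, m k : ℕ) (m i) (m j) - 2 * (m j - r) : ℤ) : ℝ) > 4 * d₀ ∧
      ((programF r (∑ k, m k : ℕ) (m i) (m j) : ℤ) : ℝ) > 4 * d₀

/-- The values of the objective `M = M₁ + ⋯ + M_L` at the feasible points. -/
def programValues (L N r : ℕ) (d₀ : ℝ) : Set ℕ :=
  {M | ∃ m : Fin L → ℕ, IsFeasible L N r d₀ m ∧ M = ∑ i, m i}

end LinearClassification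

end

open LinearClassification

namespace LinearClassification

/-! ### Gaussian densities -/

/-! The error probability of the MAP rule is comparable, up to constants, with the sum over pairs of
classes of the overlaps `∫ min (p_i f_i) (p_j f_j)`. Here `f_i` is the centred Gaussian density with
covariance `A_i + v I`, where `A_i = Φ Σ_i Φᵀ`. A determinant `det (A + v I)` is of order `v ^ (M -
rank A)`. Bounding the minimum below by a product of exponentials, and above by the Chernoff
inequality `min a b ≤ a ^ s * b ^ (1 - s)` with `s` near 0 or 1, shows that the overlap has decay
exponent `(rank (A_i + A_j) - min (rank A_i) (rank A_j)) / 2`. Hence the limit exists, and it is the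
smallest of these exponents over the pairs with positive priors. What remains is a question about
ranks.

The design takes `M_l` rows orthogonal to `R_l`, for each class `l`, and is otherwise generic. The
rows of block `i` annihilate `Σ_i`, so `rank A_i ≤ min r (M - M_i)`, while for generic subspaces and
rows `rank (A_i + A_j)` is at least `ρ = min {N, 2r, M, M + r - M_i, M + r - M_j}`. Since `max (M -
r) M_i = M - min r (M - M_i)`, the four constraints on a pair express `2ρ - min r (M - M_i) - min r
(M - M_j) > 4 d₀` for the last four candidates for `ρ`; for `ρ = N` the inequality is the assumption
on `d₀`. As the smaller of two ranks is at most their mean, this forces every pair exponent above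
`d₀`.

Genericity means that a polynomial in spanning frames and row vectors does not vanish. It is not
identically zero, because a suitable choice of coordinate subspaces and coordinate rows gives a
nonzero value; its zero set is then Lebesgue null. The laws of the `R_l` are dominated by the law of
spans of Gaussian frames, so Fubini provides good rows for almost every draw. The ranks depend on
the covariances only through bounds determined by their images, so one null set serves all
covariances. The main steps are `decayExponentGT_of_lt_pairExponent`, `exists_coordinate_design`,
`PolynomialOnLines.ae_ne_zero`, `ae_exists_generic_rows` and `lt_of_isFeasible`. -/

theorem continuous_gaussianDensity {M : ℕ} (K : Matrix (Fin M) (Fin M) ℝ) :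
    Continuous (gaussianDensity K) := by
  unfold gaussianDensity Matrix.mulVec dotProduct
  fun_prop

theorem gaussianDensity_nonneg {M : ℕ} (K : Matrix (Fin M) (Fin M) ℝ)
    (y : EuclideanSpace ℝ (Fin M)) : 0 ≤ gaussianDensity K y := by
  unfold gaussianDensity
  positivity

theorem gaussianDensity_one {M : ℕ} (y : EuclideanSpace ℝ (Fin M)) :
    gaussianDensity 1 y = (Real.sqrt ((2 * Real.pi) ^ M))⁻¹ * Real.exp (-(1 / 2) * ‖y‖ ^ 2) := by
  rw [EuclideanSpace.real_norm_sq_eq]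
  simp [gaussianDensity, dotProduct, sq]

/-- Both sides have characteristic function `exp (-‖t‖² / 2)`; on the right it is the complex
Gaussian integral with linear coefficient `Complex.I`. -/
theorem stdGaussian_eq_withDensity (M : ℕ) :
    stdGaussian (EuclideanSpace ℝ (Fin M)) =
      volume.withDensity fun y => ENNReal.ofReal (gaussianDensity 1 y) := by
  have hint : Integrable (fun y : EuclideanSpace ℝ (Fin M) => gaussianDensity 1 y) := by
    have h := (GaussianFourier.integrable_cexp_neg_mul_sq_norm_add
      (V := EuclideanSpace ℝ (Fin M)) (b := 1 / 2) (by norm_num) 0 0).norm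
    simp only [gaussianDensity_one]
    refine Integrable.const_mul ?_ _
    refine h.congr (Eventually.of_forall fun y => ?_)
    simp only [Complex.norm_exp]
    congr 1
    have : (-(1 / 2) * (‖y‖ : ℂ) ^ 2 + 0 * ((inner ℝ (0 : EuclideanSpace ℝ (Fin M)) y : ℝ) : ℂ)) =
        ((-(1 / 2) * ‖y‖ ^ 2 : ℝ) : ℂ) := by push_cast; ring
    rw [this, Complex.ofReal_re]
  have : IsFiniteMeasure (volume.withDensity fun y : EuclideanSpace ℝ (Fin M) =>
      ENNReal.ofReal (gaussianDensity 1 y)) := isFiniteMeasure_withDensity_ofReal hint.2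
  refine Measure.ext_of_charFun ?_
  ext t
  rw [charFun_stdGaussian, charFun_apply, integral_withDensity_eq_integral_toReal_smul
    ((continuous_gaussianDensity 1).measurable.ennreal_ofReal)
    (Eventually.of_forall fun _ => ENNReal.ofReal_lt_top)]
  have h := GaussianFourier.integral_cexp_neg_mul_sq_norm_add
      (V := EuclideanSpace ℝ (Fin M)) (b := 1 / 2) (by norm_num) Complex.I t
  have hpi : (0 : ℝ) < 2 * Real.pi := by positivity
  have h1 : ((Real.pi : ℂ) / (1 / 2)) ^ ((Module.finrank ℝ (EuclideanSpace ℝ (Fin M)) : ℂ) / 2) =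
      ((Real.sqrt ((2 * Real.pi) ^ M) : ℝ) : ℂ) := by
    rw [Real.sqrt_eq_rpow, ← Real.rpow_natCast, ← Real.rpow_mul hpi.le,
      Complex.ofReal_cpow hpi.le]
    simp only [finrank_euclideanSpace, Fintype.card_fin]
    push_cast
    congr 1 <;> ring
  rw [h1] at h
  have h2 : ∀ y : EuclideanSpace ℝ (Fin M), (ENNReal.ofReal (gaussianDensity 1 y)).toReal •
      Complex.exp ((inner ℝ y t : ℝ) * Complex.I) =
      (((Real.sqrt ((2 * Real.pi) ^ M))⁻¹ : ℝ) : ℂ) *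
        Complex.exp (-(1 / 2) * (‖y‖ : ℂ) ^ 2 + Complex.I * (inner ℝ t y : ℝ)) := by
    intro y
    rw [ENNReal.toReal_ofReal (gaussianDensity_nonneg _ _), gaussianDensity_one,
      Complex.exp_add, real_inner_comm, Complex.real_smul]
    push_cast
    rw [mul_comm Complex.I]
    ring
  simp only [h2]
  rw [integral_const_mul, h, ← mul_assoc, ← Complex.ofReal_mul, inv_mul_cancel₀ (by positivity)]
  simp only [Complex.ofReal_one, one_mul]
  congr 1
  rw [Complex.I_sq]
  ring

theorem stdGaussian_absolutelyContinuous (M : ℕ) :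
    stdGaussian (EuclideanSpace ℝ (Fin M)) ≪ volume := by
  rw [stdGaussian_eq_withDensity]
  exact withDensity_absolutelyContinuous _ _

-- Change of variables along the symmetric square root `B` of `K`: the quadratic form of `K⁻¹` pulls
-- back to `‖x‖²`, and the Jacobian `|det B|` is the square root of `det K`.
open scoped MatrixOrder in
theorem multivariateGaussian_eq_withDensity {M : ℕ} {K : Matrix (Fin M) (Fin M) ℝ}
    (hK : K.PosDef) :
    multivariateGaussian 0 K = volume.withDensity fun y => ENNReal.ofReal (gaussianDensity K y) := by
  set B : Matrix (Fin M) (Fin M) ℝ := CFC.sqrt K with hB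
  have hBB : B * B = K := CFC.sqrt_mul_sqrt_self K hK.posSemidef.nonneg
  have hBpos : B.PosSemidef := (Matrix.nonneg_iff_posSemidef).1 (CFC.sqrt_nonneg K)
  have hdet : B.det * B.det = K.det := by rw [← Matrix.det_mul, hBB]
  have hB0 : B.det ≠ 0 := fun h => hK.det_pos.ne' (by rw [← hdet, h, zero_mul])
  have hBT : B.transpose = B := hBpos.1
  set f := Matrix.toEuclideanCLM (𝕜 := ℝ) B with hf
  have hfdet : LinearMap.det (f : EuclideanSpace ℝ (Fin M) →ₗ[ℝ] EuclideanSpace ℝ (Fin M)) = B.det :=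
    LinearMap.det_toLpLin 2 B
  have hsqrt : Real.sqrt ((2 * Real.pi) ^ M * K.det) = Real.sqrt ((2 * Real.pi) ^ M) * |B.det| := by
    rw [Real.sqrt_mul (by positivity), ← hdet, Real.sqrt_mul_self_eq_abs]
  have hquad : ∀ x : EuclideanSpace ℝ (Fin M),
      (f x).ofLp ⬝ᵥ (K⁻¹).mulVec (f x).ofLp = ‖x‖ ^ 2 := by
    intro x
    have h1 : (f x).ofLp = B.mulVec x.ofLp := rfl
    have h2 : B * K⁻¹ * B = 1 := by
      rw [← hBB, Matrix.mul_inv_rev, ← mul_assoc, Matrix.mul_nonsing_inv _ (isUnit_iff_ne_zero.2 hB0),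
        one_mul, Matrix.nonsing_inv_mul _ (isUnit_iff_ne_zero.2 hB0)]
    rw [h1, Matrix.mulVec_mulVec, Matrix.dotProduct_mulVec, Matrix.vecMul_mulVec, hBT, ← mul_assoc,
      h2, Matrix.vecMul_one]
    rw [EuclideanSpace.real_norm_sq_eq]
    simp [dotProduct, sq]
  have hcomp : ∀ x, gaussianDensity K (f x) = |B.det|⁻¹ * gaussianDensity 1 x := by
    intro x
    rw [gaussianDensity_one, gaussianDensity, hquad, hsqrt, mul_inv]
    ring
  ext s hs
  rw [multivariateGaussian, stdGaussian_eq_withDensity, Measure.map_apply (by fun_prop) hs]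
  simp only [zero_add]
  have hfm : Measurable f := f.continuous.measurable
  rw [withDensity_apply _ (hfm hs), withDensity_apply _ hs]
  have hv : (volume : Measure (EuclideanSpace ℝ (Fin M))) =
      ENNReal.ofReal |B.det| • volume.map f := by
    have := Measure.map_linearMap_addHaar_eq_smul_addHaar
      (volume : Measure (EuclideanSpace ℝ (Fin M))) (f := (f : EuclideanSpace ℝ (Fin M) →ₗ[ℝ] _))
      (by rw [hfdet]; exact hB0)
    rw [ContinuousLinearMap.coe_coe] at this
    rw [this, hfdet, smul_smul, ← ENNReal.ofReal_mul (abs_nonneg _), abs_inv,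
      mul_inv_cancel₀ (abs_ne_zero.2 hB0)]
    simp
  conv_rhs => rw [hv]
  rw [Measure.restrict_smul, lintegral_smul_measure, setLIntegral_map hs
    (continuous_gaussianDensity K).measurable.ennreal_ofReal hfm, smul_eq_mul,
    ← lintegral_const_mul' _ _ ENNReal.ofReal_ne_top]
  refine lintegral_congr fun x => ?_
  rw [← ENNReal.ofReal_mul (abs_nonneg _)]
  congr 1
  rw [hcomp, ← mul_assoc, mul_inv_cancel₀ (abs_ne_zero.2 hB0), one_mul]

theorem lintegral_gaussianDensity {M : ℕ} {K : Matrix (Fin M) (Fin M) ℝ} (hK : K.PosDef) :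
    ∫⁻ y, ENNReal.ofReal (gaussianDensity K y) = 1 := by
  have : IsProbabilityMeasure (multivariateGaussian 0 K) := inferInstance
  have h := measure_univ (μ := multivariateGaussian 0 K)
  rwa [multivariateGaussian_eq_withDensity hK, withDensity_apply _ MeasurableSet.univ,
    setLIntegral_univ] at h

/-- The Gaussian integral. -/
theorem lintegral_exp_neg_quadratic {M : ℕ} {Q : Matrix (Fin M) (Fin M) ℝ} (hQ : Q.PosDef) :
    ∫⁻ y : EuclideanSpace ℝ (Fin M), ENNReal.ofReal (Real.exp (-(1 / 2) * (y.ofLp ⬝ᵥ Q.mulVec y.ofLp))) =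
      ENNReal.ofReal (Real.sqrt ((2 * Real.pi) ^ M / Q.det)) := by
  -- The integral is read off from the total mass of the Gaussian with covariance `Q⁻¹`.
  have h := lintegral_gaussianDensity hQ.inv
  have hd : 0 < Q.det := hQ.det_pos
  have hu : IsUnit Q.det := isUnit_iff_ne_zero.2 hd.ne'
  have hs : 0 < Real.sqrt ((2 * Real.pi) ^ M / Q.det) := by positivity
  simp only [gaussianDensity, Matrix.nonsing_inv_nonsing_inv _ hu, Matrix.det_nonsing_inv,
    Ring.inverse_eq_inv', ← div_eq_mul_inv] at h
  simp only [ENNReal.ofReal_mul (inv_nonneg.2 hs.le)] at h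
  rw [lintegral_const_mul' _ _ ENNReal.ofReal_ne_top, ENNReal.ofReal_inv_of_pos hs] at h
  rw [mul_comm, ← div_eq_mul_inv, ENNReal.div_eq_one_iff (by simpa using hs)
    ENNReal.ofReal_ne_top] at h
  exact h

theorem posDef_add_smul_one {M : ℕ} {A : Matrix (Fin M) (Fin M) ℝ} (hA : A.PosSemidef) {v : ℝ}
    (hv : 0 < v) : (A + v • (1 : Matrix (Fin M) (Fin M) ℝ)).PosDef :=
  Matrix.PosDef.posSemidef_add hA (Matrix.PosDef.one.smul hv)

theorem measurementLaw_eq_multivariateGaussian {M N : ℕ} (Φ : Matrix (Fin M) (Fin N) ℝ)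
    {S : Matrix (Fin N) (Fin N) ℝ} (hS : S.PosSemidef) {v : ℝ} (hv : 0 < v) :
    measurementLaw Φ S v =
      multivariateGaussian 0 (Φ * S * Φ.transpose + v • (1 : Matrix (Fin M) (Fin M) ℝ)) := by
  have hA : (Φ * S * Φ.transpose).PosSemidef := by
    simpa using hS.mul_mul_conjTranspose_same Φ
  have hv1 : (v • (1 : Matrix (Fin M) (Fin M) ℝ)).PosSemidef := (Matrix.PosDef.one.smul hv).posSemidef
  have hm : Measurable fun q : EuclideanSpace ℝ (Fin N) × EuclideanSpace ℝ (Fin M) =>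
      Φ.toEuclideanLin q.1 + q.2 := by
    have : Continuous Φ.toEuclideanLin := LinearMap.continuous_of_finiteDimensional _
    fun_prop
  have : IsProbabilityMeasure (measurementLaw Φ S v) :=
    Measure.isProbabilityMeasure_map hm.aemeasurable
  refine Measure.ext_of_charFun ?_
  ext t
  rw [charFun_multivariateGaussian (hA.add hv1), charFun_apply, measurementLaw,
    integral_map hm.aemeasurable (by fun_prop)]
  have hsplit : ∀ q : EuclideanSpace ℝ (Fin N) × EuclideanSpace ℝ (Fin M),
      Complex.exp ((inner ℝ (Φ.toEuclideanLin q.1 + q.2) t : ℝ) * Complex.I) =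
      Complex.exp ((inner ℝ q.1 (Φ.transpose.toEuclideanLin t) : ℝ) * Complex.I) *
        Complex.exp ((inner ℝ q.2 t : ℝ) * Complex.I) := by
    intro q
    have : (inner ℝ (Φ.toEuclideanLin q.1) t : ℝ) = inner ℝ q.1 (Φ.transpose.toEuclideanLin t) := by
      simp only [EuclideanSpace.inner_eq_star_dotProduct, Matrix.toLpLin_apply, star_trivial]
      rw [Matrix.dotProduct_mulVec, dotProduct_comm, Matrix.mulVec_transpose, dotProduct_comm]
    rw [inner_add_left, this, ← Complex.exp_add]
    push_cast
    ring_nf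
  simp only [hsplit]
  rw [integral_prod_mul (fun x => Complex.exp ((inner ℝ x (Φ.transpose.toEuclideanLin t) : ℝ) * Complex.I))
    (fun x => Complex.exp ((inner ℝ x t : ℝ) * Complex.I)), ← charFun_apply, ← charFun_apply,
    charFun_multivariateGaussian hS, charFun_multivariateGaussian hv1, ← Complex.exp_add]
  congr 1
  simp only [inner_zero_right, Matrix.toLpLin_apply, Matrix.add_mulVec, dotProduct_add]
  have : Φ.transpose.mulVec t.ofLp ⬝ᵥ S.mulVec (Φ.transpose.mulVec t.ofLp) =
      t.ofLp ⬝ᵥ (Φ * S * Φ.transpose).mulVec t.ofLp := by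
    rw [← Matrix.mulVec_mulVec, ← Matrix.mulVec_mulVec, Matrix.dotProduct_mulVec t.ofLp Φ,
      Matrix.mulVec_transpose]
  rw [this]
  push_cast
  ring

theorem measurementLaw_apply {M N : ℕ} (Φ : Matrix (Fin M) (Fin N) ℝ)
    {S : Matrix (Fin N) (Fin N) ℝ} (hS : S.PosSemidef) {v : ℝ} (hv : 0 < v)
    {s : Set (EuclideanSpace ℝ (Fin M))} (hs : MeasurableSet s) :
    measurementLaw Φ S v s = ∫⁻ y in s, ENNReal.ofReal (classDensity Φ S v y) := by
  have hA : (Φ * S * Φ.transpose).PosSemidef := by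
    simpa using hS.mul_mul_conjTranspose_same Φ
  rw [measurementLaw_eq_multivariateGaussian Φ hS hv,
    multivariateGaussian_eq_withDensity (posDef_add_smul_one hA hv), withDensity_apply _ hs]
  rfl


/-! ### Determinants and overlap integrals of Gaussian densities for small noise -/

/-- This is the characteristic polynomial evaluated at `-v`, with the sign `(-1) ^ M` cancelled. -/
theorem det_add_smul_one {M : ℕ} {A : Matrix (Fin M) (Fin M) ℝ} (hA : A.IsHermitian) (v : ℝ) :
    (A + v • (1 : Matrix (Fin M) (Fin M) ℝ)).det = ∏ i, (hA.eigenvalues i + v) := by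
  have h1 := Matrix.eval_charpoly A (-v)
  rw [hA.charpoly_eq, Polynomial.eval_prod] at h1
  have h2 : Matrix.scalar (Fin M) (-v) - A = -(A + v • (1 : Matrix (Fin M) (Fin M) ℝ)) := by
    rw [Matrix.scalar_apply, ← Matrix.smul_one_eq_diagonal, neg_smul]
    abel
  rw [h2, Matrix.det_neg] at h1
  have h3 : ∏ j, Polynomial.eval (-v) (Polynomial.X - Polynomial.C ((hA.eigenvalues j : ℝ))) =
      (-1) ^ Fintype.card (Fin M) * ∏ i, (hA.eigenvalues i + v) := by
    rw [← Finset.card_univ, ← Finset.prod_const, ← Finset.prod_mul_distrib]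
    refine Finset.prod_congr rfl fun i _ => ?_
    simp
    ring
  have h4 : ((-1 : ℝ) ^ Fintype.card (Fin M)) ≠ 0 := pow_ne_zero _ (by norm_num)
  exact mul_left_cancel₀ h4 (h1.symm.trans h3)

/-- For a positive semidefinite `A` of rank `ρ`, `det (A + v I)` is of order `v ^ (M - ρ)`. -/
theorem exists_det_add_smul_one_bounds {M : ℕ} {A : Matrix (Fin M) (Fin M) ℝ}
    (hA : A.PosSemidef) :
    ∃ c C : ℝ, 0 < c ∧ 0 < C ∧ ∀ v : ℝ, 0 < v → v ≤ 1 →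
      c * v ^ ((M : ℝ) - A.rank) ≤ (A + v • (1 : Matrix (Fin M) (Fin M) ℝ)).det ∧
      (A + v • (1 : Matrix (Fin M) (Fin M) ℝ)).det ≤ C * v ^ ((M : ℝ) - A.rank) := by
  classical
  set e := hA.1.eigenvalues with he
  have he0 : ∀ i, 0 ≤ e i := hA.eigenvalues_nonneg
  have hcard : ((Finset.univ.filter fun i => e i = 0).card : ℝ) = (M : ℝ) - A.rank := by
    rw [hA.1.rank_eq_card_non_zero_eigs, Fintype.card_subtype]
    have := Finset.card_filter_add_card_filter_not (s := (Finset.univ : Finset (Fin M)))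
      (fun i => e i = 0)
    rw [Finset.card_univ, Fintype.card_fin] at this
    rw [eq_sub_iff_add_eq]
    exact_mod_cast this
  have hpow : ∀ v : ℝ, 0 < v → v ^ ((M : ℝ) - A.rank) = ∏ i, if e i = 0 then v else 1 := by
    intro v hv
    rw [← hcard, Real.rpow_natCast, Finset.prod_ite, Finset.prod_const, Finset.prod_const_one,
      mul_one]
  refine ⟨∏ i, if e i = 0 then 1 else e i, ∏ i, if e i = 0 then 1 else e i + 1,
    Finset.prod_pos fun i _ => ?_, Finset.prod_pos fun i _ => ?_, fun v hv hv1 => ?_⟩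
  · split_ifs with h
    · exact one_pos
    · exact lt_of_le_of_ne (he0 i) (Ne.symm h)
  · split_ifs with h
    · exact one_pos
    · linarith [he0 i]
  · rw [hpow v hv, det_add_smul_one hA.1, ← Finset.prod_mul_distrib, ← Finset.prod_mul_distrib]
    constructor
    · refine Finset.prod_le_prod (fun i _ => ?_) fun i _ => ?_
      · split_ifs
        · linarith
        · linarith [he0 i]
      · have := he0 i
        split_ifs with h <;> simp only [← he] <;> linarith
    · refine Finset.prod_le_prod (fun i _ => ?_) fun i _ => ?_
      · exact add_nonneg (he0 i) hv.le
      · have := he0 i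
        split_ifs with h <;> simp only [← he] <;> linarith

theorem det_inv_add_inv {M : ℕ} {K₁ K₂ : Matrix (Fin M) (Fin M) ℝ} (h₁ : K₁.PosDef)
    (h₂ : K₂.PosDef) : (K₁⁻¹ + K₂⁻¹).det = (K₁ + K₂).det / (K₁.det * K₂.det) := by
  have u₁ : IsUnit K₁.det := isUnit_iff_ne_zero.2 h₁.det_pos.ne'
  have u₂ : IsUnit K₂.det := isUnit_iff_ne_zero.2 h₂.det_pos.ne'
  have : K₁ * (K₁⁻¹ + K₂⁻¹) * K₂ = K₁ + K₂ := by
    rw [mul_add, Matrix.mul_nonsing_inv _ u₁, add_mul, one_mul, mul_assoc,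
      Matrix.nonsing_inv_mul _ u₂, mul_one, add_comm]
  have h := congrArg Matrix.det this
  rw [Matrix.det_mul, Matrix.det_mul] at h
  rw [← h, eq_div_iff (mul_ne_zero u₁.ne_zero u₂.ne_zero)]
  ring

/-- The quadratic form of a positive definite matrix is nonnegative. -/
theorem quadratic_nonneg {M : ℕ} {Q : Matrix (Fin M) (Fin M) ℝ} (hQ : Q.PosDef)
    (x : Fin M → ℝ) : 0 ≤ x ⬝ᵥ Q.mulVec x := by
  simpa using hQ.posSemidef.dotProduct_mulVec_nonneg x

/-- Each exponential is at least the product of both, since both quadratic forms are nonnegative.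
The product is Gaussian with precision `K₁⁻¹ + K₂⁻¹`, whose determinant brings in `det (K₁ + K₂)`.
-/
theorem le_lintegral_min_gaussianDensity {M : ℕ} {K₁ K₂ : Matrix (Fin M) (Fin M) ℝ}
    (h₁ : K₁.PosDef) (h₂ : K₂.PosDef) {p q : ℝ} (hp : 0 < p) (hq : 0 < q) :
    ENNReal.ofReal (min p q * min (Real.sqrt (K₁.det / (K₁ + K₂).det))
      (Real.sqrt (K₂.det / (K₁ + K₂).det))) ≤
    ∫⁻ y, ENNReal.ofReal (min (p * gaussianDensity K₁ y) (q * gaussianDensity K₂ y)) := by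
  have d₁ := h₁.det_pos
  have d₂ := h₂.det_pos
  have d := (h₁.add h₂).det_pos
  have hpi : 0 < (2 * Real.pi) ^ M := by positivity
  set m := min (Real.sqrt ((2 * Real.pi) ^ M * K₁.det))⁻¹ (Real.sqrt ((2 * Real.pi) ^ M * K₂.det))⁻¹
    with hm
  have hm0 : 0 < m := lt_min (by positivity) (by positivity)
  have hpq : 0 < min p q := lt_min hp hq
  have hle : ∀ y : EuclideanSpace ℝ (Fin M),
      min p q * m * Real.exp (-(1 / 2) * (y.ofLp ⬝ᵥ (K₁⁻¹ + K₂⁻¹).mulVec y.ofLp)) ≤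
        min (p * gaussianDensity K₁ y) (q * gaussianDensity K₂ y) := by
    intro y
    have q₁ := quadratic_nonneg h₁.inv y.ofLp
    have q₂ := quadratic_nonneg h₂.inv y.ofLp
    rw [Matrix.add_mulVec, dotProduct_add]
    refine le_min ?_ ?_
    · rw [gaussianDensity, mul_assoc]
      refine mul_le_mul (min_le_left _ _) (mul_le_mul (min_le_left _ _)
        (Real.exp_le_exp.2 (by linarith)) (Real.exp_pos _).le (by positivity))
        (mul_pos hm0 (Real.exp_pos _)).le (by positivity)
    · rw [gaussianDensity, mul_assoc]
      refine mul_le_mul (min_le_right _ _) (mul_le_mul (min_le_right _ _)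
        (Real.exp_le_exp.2 (by linarith)) (Real.exp_pos _).le (by positivity))
        (mul_pos hm0 (Real.exp_pos _)).le (by positivity)
  refine le_trans (le_of_eq ?_) (lintegral_mono fun y => ENNReal.ofReal_le_ofReal (hle y))
  simp only [ENNReal.ofReal_mul (mul_pos hpq hm0).le]
  rw [lintegral_const_mul' _ _ ENNReal.ofReal_ne_top,
    lintegral_exp_neg_quadratic (h₁.inv.add h₂.inv), ← ENNReal.ofReal_mul (mul_pos hpq hm0).le,
    mul_assoc, det_inv_add_inv h₁ h₂, hm]
  have key : ∀ a b : ℝ, 0 < a → 0 < b → (Real.sqrt ((2 * Real.pi) ^ M * b))⁻¹ *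
      Real.sqrt ((2 * Real.pi) ^ M / ((K₁ + K₂).det / (a * b))) =
      Real.sqrt (a / (K₁ + K₂).det) := by
    intro a b ha hb
    rw [← Real.sqrt_inv, ← Real.sqrt_mul (by positivity)]
    congr 1
    field_simp
  rw [min_mul_of_nonneg _ _ (Real.sqrt_nonneg _), key _ _ d₁ d₂, mul_comm K₁.det K₂.det,
    key _ _ d₂ d₁, min_comm (Real.sqrt _)]

theorem min_le_rpow_mul_rpow {a b s : ℝ} (ha : 0 < a) (hb : 0 < b) (hs : 0 ≤ s) (hs1 : s ≤ 1) :
    min a b ≤ a ^ s * b ^ (1 - s) := by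
  have h : 0 < min a b := lt_min ha hb
  calc min a b = min a b ^ s * min a b ^ (1 - s) := by
        rw [← Real.rpow_add h]; simp
    _ ≤ a ^ s * b ^ (1 - s) := by
        exact mul_le_mul (Real.rpow_le_rpow h.le (min_le_left _ _) hs)
          (Real.rpow_le_rpow h.le (min_le_right _ _) (by linarith)) (by positivity) (by positivity)

/-- The Chernoff bound for the overlap of two centred Gaussian densities. -/
theorem exists_lintegral_min_gaussianDensity_le (M : ℕ) {p q s : ℝ} (hp : 0 < p) (hq : 0 < q)
    (hs : 0 < s) (hs1 : s < 1) :
    ∃ C : ℝ, 0 < C ∧ ∀ K₁ K₂ : Matrix (Fin M) (Fin M) ℝ, K₁.PosDef → K₂.PosDef →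
      ∫⁻ y, ENNReal.ofReal (min (p * gaussianDensity K₁ y) (q * gaussianDensity K₂ y)) ≤
        ENNReal.ofReal (C * (K₁.det ^ ((1 - s) / 2) * K₂.det ^ (s / 2) *
          (K₁ + K₂).det ^ (-(1 / 2) : ℝ))) := by
  set m := min s (1 - s) with hm
  have hm0 : 0 < m := lt_min hs (by linarith)
  set P : ℝ := (2 * Real.pi) ^ M with hP
  have hP0 : 0 < P := by positivity
  refine ⟨p ^ s * q ^ (1 - s) * (m ^ M) ^ (-(1 / 2) : ℝ), by positivity, fun K₁ K₂ h₁ h₂ => ?_⟩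
  have d₁ := h₁.det_pos
  have d₂ := h₂.det_pos
  have d := (h₁.add h₂).det_pos
  set D : ℝ := p ^ s * q ^ (1 - s) * ((P * K₁.det) ^ (-(s / 2)) * (P * K₂.det) ^ (-((1 - s) / 2)))
    with hD
  have hD0 : 0 < D := by positivity
  -- The form `s K₁⁻¹ + (1 - s) K₂⁻¹` dominates `m (K₁⁻¹ + K₂⁻¹)` with `m = min s (1 - s)`. This
  -- costs only a constant, and it makes the determinant independent of `s` up to that constant.
  have hle : ∀ y : EuclideanSpace ℝ (Fin M),
      min (p * gaussianDensity K₁ y) (q * gaussianDensity K₂ y) ≤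
      D * Real.exp (-(1 / 2) * (y.ofLp ⬝ᵥ (m • (K₁⁻¹ + K₂⁻¹)).mulVec y.ofLp)) := by
    intro y
    have q₁ := quadratic_nonneg h₁.inv y.ofLp
    have q₂ := quadratic_nonneg h₂.inv y.ofLp
    have g₁ : 0 < gaussianDensity K₁ y := by unfold gaussianDensity; positivity
    have g₂ : 0 < gaussianDensity K₂ y := by unfold gaussianDensity; positivity
    refine (min_le_rpow_mul_rpow (mul_pos hp g₁) (mul_pos hq g₂) hs.le hs1.le).trans ?_
    have hpow : ∀ (K : Matrix (Fin M) (Fin M) ℝ) (t : ℝ), 0 < K.det → gaussianDensity K y ^ t =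
        (P * K.det) ^ (-(t / 2)) * Real.exp (-(1 / 2) * (t * (y.ofLp ⬝ᵥ (K⁻¹).mulVec y.ofLp))) := by
      intro K t hK
      rw [gaussianDensity, Real.mul_rpow (by positivity) (Real.exp_pos _).le, ← Real.exp_mul,
        Real.sqrt_eq_rpow, ← Real.rpow_neg (by positivity), ← Real.rpow_mul (by positivity)]
      congr 2 <;> ring
    rw [Real.mul_rpow hp.le g₁.le, Real.mul_rpow hq.le g₂.le, hpow _ _ d₁, hpow _ _ d₂]
    calc _ = D * Real.exp (-(1 / 2) * (s * (y.ofLp ⬝ᵥ (K₁⁻¹).mulVec y.ofLp) +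
          (1 - s) * (y.ofLp ⬝ᵥ (K₂⁻¹).mulVec y.ofLp))) := by
          rw [mul_add, Real.exp_add, hD]; ring
      _ ≤ _ := by
          refine mul_le_mul_of_nonneg_left (Real.exp_le_exp.2 ?_) hD0.le
          rw [Matrix.smul_mulVec, dotProduct_smul, Matrix.add_mulVec, dotProduct_add, smul_eq_mul]
          have a₁ : m ≤ s := min_le_left _ _
          have a₂ : m ≤ 1 - s := min_le_right _ _
          nlinarith [mul_le_mul_of_nonneg_right a₁ q₁, mul_le_mul_of_nonneg_right a₂ q₂]
  refine (lintegral_mono fun y => ENNReal.ofReal_le_ofReal (hle y)).trans (le_of_eq ?_)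
  simp only [ENNReal.ofReal_mul hD0.le]
  rw [lintegral_const_mul' _ _ ENNReal.ofReal_ne_top,
    lintegral_exp_neg_quadratic ((h₁.inv.add h₂.inv).smul hm0), ← ENNReal.ofReal_mul hD0.le,
    Matrix.det_smul, det_inv_add_inv h₁ h₂, Fintype.card_fin, ← hP, hD]
  congr 1
  have e1 : Real.sqrt (P / (m ^ M * ((K₁ + K₂).det / (K₁.det * K₂.det)))) =
      P ^ (1 / 2 : ℝ) * K₁.det ^ (1 / 2 : ℝ) * K₂.det ^ (1 / 2 : ℝ) * (m ^ M) ^ (-(1 / 2) : ℝ) *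
        (K₁ + K₂).det ^ (-(1 / 2) : ℝ) := by
    have : P / (m ^ M * ((K₁ + K₂).det / (K₁.det * K₂.det))) =
        P * K₁.det * K₂.det * (m ^ M)⁻¹ * ((K₁ + K₂).det)⁻¹ := by field_simp
    rw [this, Real.sqrt_eq_rpow, Real.mul_rpow (by positivity) (by positivity),
      Real.mul_rpow (by positivity) (by positivity), Real.mul_rpow (by positivity) (by positivity),
      Real.mul_rpow (by positivity) (by positivity), Real.inv_rpow (by positivity),
      Real.inv_rpow d.le, Real.rpow_neg (by positivity), Real.rpow_neg d.le]
  have e2 : P ^ (-(s / 2)) * P ^ (-((1 - s) / 2)) * P ^ (1 / 2 : ℝ) = 1 := by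
    rw [← Real.rpow_add hP0, ← Real.rpow_add hP0]
    ring_nf
    simp
  have e3 : K₁.det ^ (-(s / 2)) * K₁.det ^ (1 / 2 : ℝ) = K₁.det ^ ((1 - s) / 2) := by
    rw [← Real.rpow_add d₁]
    ring_nf
  have e4 : K₂.det ^ (-((1 - s) / 2)) * K₂.det ^ (1 / 2 : ℝ) = K₂.det ^ (s / 2) := by
    rw [← Real.rpow_add d₂]
    ring_nf
  rw [e1, Real.mul_rpow hP0.le d₁.le, Real.mul_rpow hP0.le d₂.le, ← e3, ← e4]
  linear_combination (p ^ s * q ^ (1 - s) * K₁.det ^ (-(s / 2)) * K₁.det ^ (1 / 2 : ℝ) *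
    K₂.det ^ (-((1 - s) / 2)) * K₂.det ^ (1 / 2 : ℝ) * (m ^ M) ^ (-(1 / 2) : ℝ) *
    (K₁ + K₂).det ^ (-(1 / 2) : ℝ)) * e2


/-! ### The decay exponent of the error probability -/

/-- The decay exponent of the MAP error between two classes with noiseless measurement
covariances `A₁` and `A₂`. -/
noncomputable def pairExponent {M : ℕ} (A₁ A₂ : Matrix (Fin M) (Fin M) ℝ) : ℝ :=
  (((A₁ + A₂).rank : ℝ) - min (A₁.rank : ℝ) A₂.rank) / 2

theorem add_smul_one_add_add_smul_one {M : ℕ} (A₁ A₂ : Matrix (Fin M) (Fin M) ℝ) (v : ℝ) :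
    A₁ + v • (1 : Matrix (Fin M) (Fin M) ℝ) + (A₂ + v • (1 : Matrix (Fin M) (Fin M) ℝ)) =
      A₁ + A₂ + (2 * v) • (1 : Matrix (Fin M) (Fin M) ℝ) := by
  rw [mul_smul, two_smul]
  abel

theorem exists_le_lintegral_min {M : ℕ} {A₁ A₂ : Matrix (Fin M) (Fin M) ℝ} (h₁ : A₁.PosSemidef)
    (h₂ : A₂.PosSemidef) {p q : ℝ} (hp : 0 < p) (hq : 0 < q) :
    ∃ c : ℝ, 0 < c ∧ ∀ v : ℝ, 0 < v → v ≤ 1 / 2 →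
      ENNReal.ofReal (c * v ^ pairExponent A₁ A₂) ≤
        ∫⁻ y, ENNReal.ofReal (min (p * gaussianDensity (A₁ + v • 1) y)
          (q * gaussianDensity (A₂ + v • 1) y)) := by
  obtain ⟨c₁, _, hc₁, _, b₁⟩ := exists_det_add_smul_one_bounds h₁
  obtain ⟨c₂, _, hc₂, _, b₂⟩ := exists_det_add_smul_one_bounds h₂
  obtain ⟨_, C, _, hC, b⟩ := exists_det_add_smul_one_bounds (h₁.add h₂)
  set ρ : ℝ := ((A₁ + A₂).rank : ℝ) with hρ
  -- The sum of the two covariances carries noise `2 v`: hence the factor `2 ^ (M - ρ)` and the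
  -- restriction `v ≤ 1 / 2`.
  set C' : ℝ := C * 2 ^ ((M : ℝ) - ρ) with hC'
  have hC'0 : 0 < C' := by positivity
  refine ⟨min p q * min (Real.sqrt (c₁ / C')) (Real.sqrt (c₂ / C')), by positivity,
    fun v hv hv1 => ?_⟩
  refine le_trans (ENNReal.ofReal_le_ofReal ?_) (le_lintegral_min_gaussianDensity
    (posDef_add_smul_one h₁ hv) (posDef_add_smul_one h₂ hv) hp hq)
  have hd := b (2 * v) (by linarith) (by linarith)
  have hd0 : 0 < (A₁ + A₂ + (2 * v) • (1 : Matrix (Fin M) (Fin M) ℝ)).det :=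
    (posDef_add_smul_one (h₁.add h₂) (by linarith)).det_pos
  rw [add_smul_one_add_add_smul_one]
  have key : ∀ (A : Matrix (Fin M) (Fin M) ℝ) (c : ℝ), 0 < c →
      c * v ^ ((M : ℝ) - A.rank) ≤ (A + v • (1 : Matrix (Fin M) (Fin M) ℝ)).det →
      min (A₁.rank : ℝ) A₂.rank ≤ A.rank →
      Real.sqrt (c / C') * v ^ pairExponent A₁ A₂ ≤
        Real.sqrt ((A + v • (1 : Matrix (Fin M) (Fin M) ℝ)).det /
          (A₁ + A₂ + (2 * v) • (1 : Matrix (Fin M) (Fin M) ℝ)).det) := by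
    intro A c hc hA hmin
    have h1 : v ^ pairExponent A₁ A₂ ≤ v ^ ((ρ - A.rank) * (1 / 2)) := by
      refine Real.rpow_le_rpow_of_exponent_ge hv (by linarith) ?_
      rw [pairExponent]
      linarith
    rw [Real.rpow_mul hv.le, ← Real.sqrt_eq_rpow] at h1
    refine (mul_le_mul_of_nonneg_left h1 (Real.sqrt_nonneg _)).trans ?_
    rw [← Real.sqrt_mul (by positivity)]
    refine Real.sqrt_le_sqrt ?_
    rw [le_div_iff₀ hd0]
    refine le_trans (mul_le_mul_of_nonneg_left hd.2 (by positivity)) (le_trans (le_of_eq ?_) hA)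
    rw [Real.mul_rpow (by norm_num) hv.le,
      show c / C' * v ^ (ρ - A.rank) * (C * (2 ^ ((M : ℝ) - ρ) * v ^ ((M : ℝ) - ρ))) =
        c / C' * C' * (v ^ (ρ - A.rank) * v ^ ((M : ℝ) - ρ)) by rw [hC']; ring,
      div_mul_cancel₀ _ hC'0.ne', ← Real.rpow_add hv]
    congr 2
    ring
  rw [mul_assoc, min_mul_of_nonneg (Real.sqrt _) _ (by positivity)]
  exact mul_le_mul_of_nonneg_left (min_le_min
    (key A₁ c₁ hc₁ (b₁ v hv (by linarith)).1 (min_le_left _ _))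
    (key A₂ c₂ hc₂ (b₂ v hv (by linarith)).1 (min_le_right _ _))) (lt_min hp hq).le

/-- The Chernoff exponent improves as `s` tends to the endpoint favouring the smaller rank. The
endpoint itself is excluded because its constant degenerates, whence the loss `ε`. -/
theorem exists_convex_comb_le_min_add (a b : ℝ) {ε : ℝ} (hε : 0 < ε) :
    ∃ s : ℝ, 0 < s ∧ s < 1 ∧ (1 - s) * a + s * b ≤ min a b + ε := by
  set t : ℝ := ε / (ε + |b - a| + 1) with ht
  have hD : 0 < ε + |b - a| + 1 := by positivity
  have ht0 : 0 < t := by positivity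
  have ht1 : t < 1 := by
    rw [ht, div_lt_one hD]
    linarith [abs_nonneg (b - a)]
  have htm : t * |b - a| ≤ ε := by
    rw [ht, div_mul_eq_mul_div, div_le_iff₀ hD]
    nlinarith [abs_nonneg (b - a)]
  rcases le_total a b with h | h
  · refine ⟨t, ht0, ht1, ?_⟩
    rw [abs_of_nonneg (by linarith)] at htm
    rw [min_eq_left h]
    linarith
  · refine ⟨1 - t, by linarith, by linarith, ?_⟩
    rw [abs_of_nonpos (by linarith)] at htm
    rw [min_eq_right h]
    linarith

theorem exists_lintegral_min_le {M : ℕ} {A₁ A₂ : Matrix (Fin M) (Fin M) ℝ} (h₁ : A₁.PosSemidef)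
    (h₂ : A₂.PosSemidef) {p q : ℝ} (hp : 0 < p) (hq : 0 < q) {ε : ℝ} (hε : 0 < ε) :
    ∃ C : ℝ, 0 < C ∧ ∀ v : ℝ, 0 < v → v ≤ 1 / 2 →
      ∫⁻ y, ENNReal.ofReal (min (p * gaussianDensity (A₁ + v • 1) y)
          (q * gaussianDensity (A₂ + v • 1) y)) ≤
        ENNReal.ofReal (C * v ^ (pairExponent A₁ A₂ - ε)) := by
  obtain ⟨s, hs, hs1, hsε⟩ := exists_convex_comb_le_min_add (A₁.rank : ℝ) A₂.rank
    (ε := 2 * ε) (by linarith)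
  obtain ⟨C₀, hC₀, hle⟩ := exists_lintegral_min_gaussianDensity_le M hp hq hs hs1
  obtain ⟨_, C₁, _, hC₁, b₁⟩ := exists_det_add_smul_one_bounds h₁
  obtain ⟨_, C₂, _, hC₂, b₂⟩ := exists_det_add_smul_one_bounds h₂
  obtain ⟨c, _, hc, _, b⟩ := exists_det_add_smul_one_bounds (h₁.add h₂)
  set ρ : ℝ := ((A₁ + A₂).rank : ℝ) with hρ
  refine ⟨C₀ * (C₁ ^ ((1 - s) / 2) * C₂ ^ (s / 2) * (c * 2 ^ ((M : ℝ) - ρ)) ^ (-(1 / 2) : ℝ)),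
    by positivity, fun v hv hv1 => ?_⟩
  have p₁ := posDef_add_smul_one h₁ hv
  have p₂ := posDef_add_smul_one h₂ hv
  refine (hle _ _ p₁ p₂).trans (ENNReal.ofReal_le_ofReal ?_)
  rw [mul_assoc C₀]
  refine mul_le_mul_of_nonneg_left ?_ hC₀.le
  rw [add_smul_one_add_add_smul_one]
  have hd := (b (2 * v) (by linarith) (by linarith)).1
  have e₁ : (A₁ + v • (1 : Matrix (Fin M) (Fin M) ℝ)).det ^ ((1 - s) / 2) ≤
      C₁ ^ ((1 - s) / 2) * v ^ (((M : ℝ) - A₁.rank) * ((1 - s) / 2)) := by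
    rw [Real.rpow_mul hv.le, ← Real.mul_rpow hC₁.le (by positivity)]
    exact Real.rpow_le_rpow p₁.det_pos.le (b₁ v hv (by linarith)).2 (by linarith)
  have e₂ : (A₂ + v • (1 : Matrix (Fin M) (Fin M) ℝ)).det ^ (s / 2) ≤
      C₂ ^ (s / 2) * v ^ (((M : ℝ) - A₂.rank) * (s / 2)) := by
    rw [Real.rpow_mul hv.le, ← Real.mul_rpow hC₂.le (by positivity)]
    exact Real.rpow_le_rpow p₂.det_pos.le (b₂ v hv (by linarith)).2 (by linarith)
  have e₃ : (A₁ + A₂ + (2 * v) • (1 : Matrix (Fin M) (Fin M) ℝ)).det ^ (-(1 / 2) : ℝ) ≤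
      (c * 2 ^ ((M : ℝ) - ρ)) ^ (-(1 / 2) : ℝ) * v ^ (((M : ℝ) - ρ) * (-(1 / 2))) := by
    rw [Real.rpow_mul hv.le, ← Real.mul_rpow (by positivity) (by positivity)]
    rw [Real.mul_rpow (by norm_num) hv.le, ← mul_assoc] at hd
    exact Real.rpow_le_rpow_of_nonpos (by positivity) hd (by norm_num)
  refine (mul_le_mul (mul_le_mul e₁ e₂ (Real.rpow_nonneg p₂.det_pos.le _) (by positivity)) e₃
    (Real.rpow_nonneg (posDef_add_smul_one (h₁.add h₂) (by linarith)).det_pos.le _)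
    (by positivity)).trans ?_
  have hexp : v ^ (((M : ℝ) - A₁.rank) * ((1 - s) / 2)) * v ^ (((M : ℝ) - A₂.rank) * (s / 2)) *
      v ^ (((M : ℝ) - ρ) * (-(1 / 2))) ≤ v ^ (pairExponent A₁ A₂ - ε) := by
    rw [← Real.rpow_add hv, ← Real.rpow_add hv]
    refine Real.rpow_le_rpow_of_exponent_ge hv (by linarith) ?_
    rw [pairExponent]
    linarith
  refine le_trans (le_of_eq ?_) (mul_le_mul_of_nonneg_left hexp (a := C₁ ^ ((1 - s) / 2) *
    C₂ ^ (s / 2) * (c * 2 ^ ((M : ℝ) - ρ)) ^ (-(1 / 2) : ℝ)) (by positivity))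
  ring

/-- Bounds of polynomial order determine the decay exponent. -/
theorem tendsto_neg_log_div_log {F : ℝ → ℝ≥0∞} {e : ℝ}
    (hlow : ∃ c : ℝ, 0 < c ∧ ∀ v : ℝ, 0 < v → v ≤ 1 / 2 → ENNReal.ofReal (c * v ^ e) ≤ F v)
    (hupp : ∀ ε : ℝ, 0 < ε → ∃ C : ℝ, 0 < C ∧ ∀ v : ℝ, 0 < v → v ≤ 1 / 2 →
      F v ≤ ENNReal.ofReal (C * v ^ (e - ε))) :
    Tendsto (fun v : ℝ => -(F v).log / ((Real.log (1 / v) : ℝ) : EReal)) (𝓝[>] 0)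
      (𝓝 (e : EReal)) := by
  have hL : Tendsto (fun v : ℝ => Real.log (1 / v)) (𝓝[>] 0) atTop := by
    simp only [one_div]
    exact Real.tendsto_log_atTop.comp tendsto_inv_nhdsGT_zero
  have hlim : ∀ C d : ℝ, Tendsto (fun v : ℝ => d - Real.log C / Real.log (1 / v)) (𝓝[>] 0)
      (𝓝 d) := by
    intro C d
    simpa using (hL.const_div_atTop (Real.log C)).const_sub d
  have hev : ∀ᶠ v : ℝ in 𝓝[>] 0, 0 < v ∧ v ≤ 1 / 2 := by
    filter_upwards [Ioc_mem_nhdsGT (show (0 : ℝ) < 1 / 2 by norm_num)] with v hv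
    exact ⟨hv.1, hv.2⟩
  have hval : ∀ C d v : ℝ, 0 < C → 0 < v → v ≤ 1 / 2 →
      -(ENNReal.ofReal (C * v ^ d)).log / ((Real.log (1 / v) : ℝ) : EReal) =
        ((d - Real.log C / Real.log (1 / v) : ℝ) : EReal) := by
    intro C d v hC hv hv1
    have hLpos : 0 < Real.log (1 / v) := Real.log_pos (by rw [lt_div_iff₀ hv]; linarith)
    rw [ENNReal.log_ofReal_of_pos (by positivity), ← EReal.coe_neg, ← EReal.coe_div]
    congr 1
    rw [Real.log_mul hC.ne' (by positivity), Real.log_rpow hv]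
    rw [one_div, Real.log_inv] at hLpos ⊢
    have : Real.log v ≠ 0 := by linarith
    field_simp
    ring
  have hmono : ∀ (x y : ℝ≥0∞) (v : ℝ), 0 < v → v ≤ 1 / 2 → x ≤ y →
      -y.log / ((Real.log (1 / v) : ℝ) : EReal) ≤ -x.log / ((Real.log (1 / v) : ℝ) : EReal) := by
    intro x y v hv hv1 hxy
    have hLpos : 0 < Real.log (1 / v) := Real.log_pos (by rw [lt_div_iff₀ hv]; linarith)
    refine EReal.div_le_div_right_of_nonneg (EReal.coe_nonneg.2 hLpos.le) ?_
    exact EReal.neg_le_neg_iff.2 (ENNReal.log_monotone hxy)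
  refine tendsto_order.2 ⟨fun a ha => ?_, fun a ha => ?_⟩
  · obtain ⟨x, hax, hxe⟩ := EReal.lt_iff_exists_real_btwn.1 ha
    have hxe' : x < e := EReal.coe_lt_coe_iff.1 hxe
    obtain ⟨C, hC, hF⟩ := hupp ((e - x) / 2) (by linarith)
    filter_upwards [hev, (hlim C (e - (e - x) / 2)).eventually
      (lt_mem_nhds (show x < e - (e - x) / 2 by linarith))] with v hv hxv
    refine hax.trans (lt_of_lt_of_le (EReal.coe_lt_coe_iff.2 hxv) ?_)
    rw [← hval C _ v hC hv.1 hv.2]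
    exact hmono _ _ v hv.1 hv.2 (hF v hv.1 hv.2)
  · obtain ⟨x, hex, hxa⟩ := EReal.lt_iff_exists_real_btwn.1 ha
    obtain ⟨c, hc, hF⟩ := hlow
    filter_upwards [hev, (hlim c e).eventually
      (gt_mem_nhds (EReal.coe_lt_coe_iff.1 hex))] with v hv hxv
    refine lt_trans (lt_of_le_of_lt ?_ (EReal.coe_lt_coe_iff.2 hxv)) hxa
    rw [← hval c _ v hc hv.1 hv.2]
    exact hmono _ _ v hv.1 hv.2 (hF v hv.1 hv.2)

/-! ### From pairwise overlaps to the misclassification probability -/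

section ErrorProb

variable {L M N : ℕ} {p : Fin L → ℝ} {S : Fin L → Matrix (Fin N) (Fin N) ℝ}
  {Φ : Matrix (Fin M) (Fin N) ℝ} {v : ℝ} {c : EuclideanSpace ℝ (Fin M) → Fin L}

theorem ofReal_mul_measurementLaw_apply {T : Matrix (Fin N) (Fin N) ℝ} (hT : T.PosSemidef)
    (hv : 0 < v) {a : ℝ} (ha : 0 ≤ a) {s : Set (EuclideanSpace ℝ (Fin M))}
    (hs : MeasurableSet s) :
    ENNReal.ofReal a * measurementLaw Φ T v s =
      ∫⁻ y in s, ENNReal.ofReal (a * classDensity Φ T v y) := by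
  rw [measurementLaw_apply Φ hT hv hs, ← lintegral_const_mul' _ _ ENNReal.ofReal_ne_top]
  simp only [ENNReal.ofReal_mul ha]

/-- Wherever `c y ≠ i` class `i` is in error, and elsewhere class `j` is, so each `y` contributes
one of the two integrands. -/
theorem lintegral_min_le_errorProb (hp : ∀ i, 0 ≤ p i) (hS : ∀ i, (S i).PosSemidef) (hv : 0 < v)
    (hc : IsMAP p S Φ v c) {i j : Fin L} (hij : i ≠ j) :
    ∫⁻ y, ENNReal.ofReal (min (p i * classDensity Φ (S i) v y) (p j * classDensity Φ (S j) v y)) ≤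
      errorProb p S Φ v c := by
  have hm : ∀ k, MeasurableSet {y | c y ≠ k} := fun k => (hc.1 (measurableSet_singleton k)).compl
  have h2 : ENNReal.ofReal (p i) * measurementLaw Φ (S i) v {y | c y ≠ i} +
      ENNReal.ofReal (p j) * measurementLaw Φ (S j) v {y | c y ≠ j} ≤ errorProb p S Φ v c := by
    rw [errorProb, ← Finset.sum_pair hij
      (f := fun k => ENNReal.ofReal (p k) * measurementLaw Φ (S k) v {y | c y ≠ k})]
    exact Finset.sum_le_sum_of_subset (Finset.subset_univ _)
  refine le_trans ?_ h2
  rw [ofReal_mul_measurementLaw_apply (hS i) hv (hp i) (hm i),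
    ofReal_mul_measurementLaw_apply (hS j) hv (hp j) (hm j),
    ← lintegral_add_compl _ (hm i)]
  refine add_le_add ?_ ?_
  · exact lintegral_mono fun y => ENNReal.ofReal_le_ofReal (min_le_left _ _)
  · refine (lintegral_mono_set fun y hy => ?_).trans
      (lintegral_mono fun y => ENNReal.ofReal_le_ofReal (min_le_right _ _))
    simp only [Set.mem_compl_iff, Set.mem_ofPred_eq, not_not] at hy
    rw [Set.mem_ofPred_eq, hy]
    exact hij

/-- Where the classifier answers `j`, maximality gives `p_i f_i ≤ p_j f_j`, so the integrand of
class `i` is already the minimum. -/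
theorem errorProb_le_sum (hp : ∀ i, 0 ≤ p i) (hS : ∀ i, (S i).PosSemidef) (hv : 0 < v)
    (hc : IsMAP p S Φ v c) :
    errorProb p S Φ v c ≤ ∑ i, ∑ j ∈ Finset.univ.filter (· ≠ i),
      ∫⁻ y, ENNReal.ofReal
        (min (p i * classDensity Φ (S i) v y) (p j * classDensity Φ (S j) v y)) := by
  classical
  have hm : ∀ k, MeasurableSet {y | c y = k} := fun k => hc.1 (measurableSet_singleton k)
  refine Finset.sum_le_sum fun i _ => ?_
  have hset : {y | c y ≠ i} = ⋃ j ∈ Finset.univ.filter (· ≠ i), {y | c y = j} := by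
    ext y
    simp
  rw [ofReal_mul_measurementLaw_apply (hS i) hv (hp i)
    (show MeasurableSet {y | c y ≠ i} from (hm i).compl)]
  refine (lintegral_mono_set (t := ⋃ j ∈ Finset.univ.filter (· ≠ i), {y | c y = j}) hset.le).trans ?_
  rw [lintegral_biUnion_finset (fun a _ b _ hab => Set.disjoint_left.2 fun y ha hb =>
    hab (by rw [← (show c y = a from ha), (show c y = b from hb)])) fun j _ => hm j]
  refine Finset.sum_le_sum fun j _ => ?_
  refine le_trans (setLIntegral_mono' (hm j) fun y hy => ENNReal.ofReal_le_ofReal ?_)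
    (setLIntegral_le_lintegral _ _)
  refine le_min le_rfl ?_
  have := hc.2 y i
  rwa [show c y = j from hy] at this

theorem decayExponentGT_of_lt_pairExponent (hp : ∀ i, 0 ≤ p i) (hS : ∀ i, (S i).PosSemidef)
    {d₀ : ℝ}
    (h : ∀ i j, i ≠ j →
      d₀ < pairExponent (Φ * S i * Φ.transpose) (Φ * S j * Φ.transpose)) :
    DecayExponentGT p S Φ d₀ := by
  classical
  intro c hc
  have hA : ∀ i, (Φ * S i * Φ.transpose).PosSemidef := fun i => by
    simpa using (hS i).mul_mul_conjTranspose_same Φ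
  -- Pairs with a vanishing prior have zero overlap, so they must not enter the minimum of the
  -- exponents.
  set E : Finset (Fin L × Fin L) :=
    Finset.univ.filter fun q => q.1 ≠ q.2 ∧ 0 < p q.1 ∧ 0 < p q.2 with hE
  set I : ℝ → Fin L × Fin L → ℝ≥0∞ := fun v q => ∫⁻ y, ENNReal.ofReal
    (min (p q.1 * classDensity Φ (S q.1) v y) (p q.2 * classDensity Φ (S q.2) v y)) with hI
  have hzero : ∀ v i j, i ≠ j → (i, j) ∉ E → I v (i, j) = 0 := by
    intro v i j hij hnot
    have h0 : p i = 0 ∨ p j = 0 := by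
      by_contra hcon
      push Not at hcon
      exact hnot (by simpa [hE, hij] using
        ⟨lt_of_le_of_ne (hp i) hcon.1.symm, lt_of_le_of_ne (hp j) hcon.2.symm⟩)
    simp only [hI]
    rw [← lintegral_zero (α := EuclideanSpace ℝ (Fin M))]
    refine lintegral_congr fun y => ENNReal.ofReal_of_nonpos ?_
    rcases h0 with h0 | h0
    · exact (min_le_left _ _).trans (by rw [h0, zero_mul])
    · exact (min_le_right _ _).trans (by rw [h0, zero_mul])
  have hupper : ∀ v, 0 < v → errorProb p S Φ v (c v) ≤ ∑ q ∈ E, I v q := by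
    intro v hv
    refine (errorProb_le_sum hp hS hv (hc v hv)).trans (le_of_eq ?_)
    rw [Finset.sum_sigma']
    have hE' : E ⊆ (Finset.univ.filter fun q : Fin L × Fin L => q.2 ≠ q.1) := fun q hq => by
      simp only [hE, Finset.mem_filter, Finset.mem_univ, true_and] at hq ⊢
      exact hq.1.symm
    rw [Finset.sum_subset hE' fun q hq hqE => hzero v q.1 q.2 (by simpa [eq_comm] using hq) hqE]
    refine Finset.sum_bij (fun x _ => (x.1, x.2)) (fun x hx => ?_) (fun x _ y _ hxy => ?_)
      (fun q hq => ⟨⟨q.1, q.2⟩, ?_, rfl⟩) fun x _ => rfl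
    · simpa using hx
    · obtain ⟨x1, x2⟩ := x
      obtain ⟨y1, y2⟩ := y
      simp only [Prod.mk.injEq] at hxy
      rw [hxy.1, hxy.2]
    · simpa using hq
  -- Without two classes of positive prior the error is exactly 0 and the exponent is `⊤`.
  rcases E.eq_empty_or_nonempty with hEe | hEn
  · refine ⟨⊤, ?_, EReal.coe_lt_top _⟩
    refine tendsto_const_nhds.congr' ?_
    filter_upwards [Ioc_mem_nhdsGT (show (0 : ℝ) < 1 / 2 by norm_num)] with v hv
    have h0 : errorProb p S Φ v (c v) = 0 := by
      have := hupper v hv.1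
      rw [hEe, Finset.sum_empty] at this
      exact le_antisymm this zero_le
    have hLpos : 0 < Real.log (1 / v) := Real.log_pos (by rw [lt_div_iff₀ hv.1]; linarith [hv.2])
    rw [h0, ENNReal.log_zero, EReal.neg_bot,
      EReal.top_div_of_pos_ne_top (EReal.coe_pos.2 hLpos) (EReal.coe_ne_top _)]
  · set e : Fin L × Fin L → ℝ :=
      fun q => pairExponent (Φ * S q.1 * Φ.transpose) (Φ * S q.2 * Φ.transpose) with he
    -- The pair with the smallest exponent dominates the sum as the noise vanishes.
    obtain ⟨q₀, hq₀, hmin⟩ := E.exists_min_image e hEn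
    have hmem : ∀ q ∈ E, q.1 ≠ q.2 ∧ 0 < p q.1 ∧ 0 < p q.2 := fun q hq => by
      simpa [hE] using hq
    refine ⟨(e q₀ : EReal), tendsto_neg_log_div_log ?_ fun ε hε => ?_,
      EReal.coe_lt_coe_iff.2 (h _ _ (hmem q₀ hq₀).1)⟩
    · obtain ⟨a, ha, hb⟩ := exists_le_lintegral_min (hA q₀.1) (hA q₀.2) (hmem q₀ hq₀).2.1
        (hmem q₀ hq₀).2.2
      exact ⟨a, ha, fun v hv hv1 => (hb v hv hv1).trans
        (lintegral_min_le_errorProb hp hS hv (hc v hv) (hmem q₀ hq₀).1)⟩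
    · have hex : ∀ q : Fin L × Fin L, ∃ C : ℝ, 0 < C ∧ (q ∈ E → ∀ v : ℝ, 0 < v → v ≤ 1 / 2 →
          I v q ≤ ENNReal.ofReal (C * v ^ (e q - ε))) := fun q => by
        by_cases hq : q ∈ E
        · obtain ⟨C, hC, hb⟩ := exists_lintegral_min_le (hA q.1) (hA q.2) (hmem q hq).2.1
            (hmem q hq).2.2 hε
          exact ⟨C, hC, fun _ => hb⟩
        · exact ⟨1, one_pos, fun h' => absurd h' hq⟩
      choose C hC hb using hex
      refine ⟨∑ q ∈ E, C q, Finset.sum_pos (fun q _ => hC q) hEn, fun v hv hv1 => ?_⟩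
      refine (hupper v hv).trans ?_
      rw [Finset.sum_mul, ENNReal.ofReal_sum_of_nonneg fun q _ =>
        mul_nonneg (hC q).le (Real.rpow_nonneg hv.le _)]
      refine Finset.sum_le_sum fun q hq => (hb q hq v hv hv1).trans (ENNReal.ofReal_le_ofReal ?_)
      refine mul_le_mul_of_nonneg_left ?_ (hC q).le
      exact Real.rpow_le_rpow_of_exponent_ge hv (by linarith) (by linarith [hmin q hq])

end ErrorProb


/-! ### Coordinate subspaces in general position -/

theorem sigma_fin_ext {L : ℕ} {m : Fin L → ℕ} {q q' : (l : Fin L) × Fin (m l)}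
    (h : q.1 = q'.1) (h' : (q.2 : ℕ) = q'.2) : q = q' := by
  obtain ⟨l, k⟩ := q
  obtain ⟨l', k'⟩ := q'
  obtain rfl : l = l' := h
  rw [show k = k' from Fin.ext h']

/-- The rows of all blocks, those of the blocks `i` and `j` being truncated to the first `r`. -/
theorem le_card_truncated_rows {L r ρ : ℕ} {m : Fin L → ℕ} {i j : Fin L} (hij : i ≠ j)
    (h1 : ρ ≤ 2 * r) (h2 : ρ ≤ ∑ l, m l) (h3 : ρ + m i ≤ ∑ l, m l + r)
    (h4 : ρ + m j ≤ ∑ l, m l + r) :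
    ρ ≤ (Finset.univ.filter fun q : (l : Fin L) × Fin (m l) =>
      (q.1 = i ∨ q.1 = j) → (q.2 : ℕ) < r).card := by
  classical
  have hset : (Finset.univ.filter fun q : (l : Fin L) × Fin (m l) =>
      (q.1 = i ∨ q.1 = j) → (q.2 : ℕ) < r) =
      Finset.univ.sigma fun l => Finset.univ.filter fun k : Fin (m l) =>
        (l = i ∨ l = j) → (k : ℕ) < r := by
    ext q
    simp
  rw [hset, Finset.card_sigma]
  have hcard : ∀ l, (Finset.univ.filter fun k : Fin (m l) => (l = i ∨ l = j) → (k : ℕ) < r).card =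
      if l = i ∨ l = j then min (m l) r else m l := by
    intro l
    split_ifs with h
    · simp only [h, true_imp_iff]
      rw [Fin.card_filter_val_lt]
    · simp [h]
  simp only [hcard]
  have hj : j ∈ Finset.univ.erase i := by simp [hij.symm]
  rw [← Finset.add_sum_erase _ _ (Finset.mem_univ i), ← Finset.add_sum_erase _ _ hj] at h2 h3 h4 ⊢
  have hrest : ∑ l ∈ (Finset.univ.erase i).erase j, (if l = i ∨ l = j then min (m l) r else m l) =
      ∑ l ∈ (Finset.univ.erase i).erase j, m l := by
    refine Finset.sum_congr rfl fun l hl => ?_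
    simp only [Finset.mem_erase, Finset.mem_univ, and_true] at hl
    rw [if_neg (by tauto)]
  rw [hrest]
  simp only [true_or, or_true, if_true]
  omega

theorem exists_embedding_avoiding {N r : ℕ} (C : Finset (Fin N)) (h : C.card + r ≤ N) :
    ∃ σ : Fin r ↪ Fin N, ∀ k, σ k ∉ C := by
  have hc : r ≤ Cᶜ.card := by
    rw [Finset.card_compl, Fintype.card_fin]
    omega
  obtain ⟨t, ht, hcard⟩ := Finset.exists_subset_card_eq hc
  refine ⟨(t.equivFinOfCardEq hcard).symm.toEmbedding.trans (Function.Embedding.subtype _),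
    fun k => ?_⟩
  exact Finset.mem_compl.1 (ht ((t.equivFinOfCardEq hcard).symm k).2)

/-- There are coordinate subspaces `span (e_{σ_l k})_k` and rows `e_{c s}` orthogonal to the
subspace of their block, with distinct `c s` in the coordinates of the subspaces `i` and `j`. -/
theorem exists_coordinate_design {L N r ρ : ℕ} {m : Fin L → ℕ} (hr : r < N)
    (hm : ∀ l, m l + r ≤ N) {i j : Fin L} (hij : i ≠ j)
    (h0 : ρ ≤ N) (h1 : ρ ≤ 2 * r) (h2 : ρ ≤ ∑ l, m l) (h3 : ρ + m i ≤ ∑ l, m l + r)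
    (h4 : ρ + m j ≤ ∑ l, m l + r) :
    ∃ (σ : Fin L → Fin r ↪ Fin N) (rows : Fin ρ ↪ (l : Fin L) × Fin (m l)) (c : Fin ρ ↪ Fin N),
      (∀ s, c s ∉ Set.range (σ (rows s).1)) ∧
      ∀ s, c s ∈ Set.range (σ i) ∪ Set.range (σ j) := by
  classical
  obtain ⟨T, hT, hTcard⟩ := Finset.exists_subset_card_eq (le_card_truncated_rows hij h1 h2 h3 h4)
  set rows : Fin ρ ↪ (l : Fin L) × Fin (m l) :=
    (T.equivFinOfCardEq hTcard).symm.toEmbedding.trans (Function.Embedding.subtype _) with hrows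
  have hlt : ∀ s, ((rows s).1 = i ∨ (rows s).1 = j) → ((rows s).2 : ℕ) < r := fun s =>
    (Finset.mem_filter.1 (hT ((T.equivFinOfCardEq hTcard).symm s).2)).2
  have hlt' : ∀ s, ((rows s).2 : ℕ) + r < N := fun s => by
    have := hm (rows s).1
    have := (rows s).2.2
    omega
  -- The subspace of `i` will be spanned by the first `r` coordinates and that of `j` by the last
  -- `r`. Rows of block `i` are numbered from the top and those of block `j` from the bottom. As `m
  -- l + r ≤ N`, each stays outside its own subspace and the two ranges do not meet; truncation to
  -- `r` rows puts each inside the other subspace.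
  set f : Fin ρ → Fin N := fun s =>
    if (rows s).1 = i then ⟨N - 1 - (rows s).2, by omega⟩
    else ⟨(rows s).2, by have := hlt' s; omega⟩ with hf
  -- The coordinates covered by the subspaces `i` and `j`; there are at least `min N (2 * r)` of
  -- them, hence at least `ρ`.
  set W : Finset (Fin N) := Finset.univ.filter fun x => (x : ℕ) < r ∨ N - r ≤ (x : ℕ) with hW
  have hWcard : ρ ≤ W.card := by
    have hcompl : Wᶜ.card ≤ (Finset.Ico r (N - r)).card := by
      refine Finset.card_le_card_of_injOn Fin.val (fun x hx => ?_) (Fin.val_injective.injOn)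
      simp only [hW, Finset.coe_compl, Set.mem_compl_iff, Finset.mem_coe, Finset.mem_filter,
        Finset.mem_univ, true_and] at hx
      simp only [Finset.coe_Ico, Set.mem_Ico]
      omega
    rw [Finset.card_compl, Fintype.card_fin, Nat.card_Ico] at hcompl
    omega
  set s₀ : Finset (Fin ρ) := Finset.univ.filter fun s => (rows s).1 = i ∨ (rows s).1 = j with hs₀
  have hfW : s₀.image f ⊆ W := by
    intro x hx
    obtain ⟨s, hs, rfl⟩ := Finset.mem_image.1 hx
    have hs' := (Finset.mem_filter.1 hs).2
    have := hlt s hs'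
    simp only [hW, hf, Finset.mem_filter, Finset.mem_univ, true_and]
    split_ifs
    · right
      simp only
      omega
    · left
      exact this
  have hinj : Set.InjOn f s₀ := by
    intro s hs t ht hst
    have hs' := (Finset.mem_filter.1 (Finset.mem_coe.1 hs)).2
    have ht' := (Finset.mem_filter.1 (Finset.mem_coe.1 ht)).2
    have e1 := hlt s hs'
    have e2 := hlt t ht'
    have e3 := hlt' s
    have e4 := hlt' t
    refine rows.injective ?_
    simp only [hf] at hst
    split_ifs at hst with a b b <;> simp only [Fin.mk.injEq] at hst
    · exact sigma_fin_ext (a.trans b.symm) (by omega)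
    · omega
    · omega
    · exact sigma_fin_ext ((hs'.resolve_left a).trans (ht'.resolve_left b).symm) hst
  obtain ⟨t, htl, htr, htcard⟩ := Finset.exists_subsuperset_card_eq hfW
    (show (s₀.image f).card ≤ ρ from Finset.card_image_le.trans (by
      simpa using Finset.card_le_univ s₀)) hWcard
  -- Rows of the other blocks receive arbitrary unused coordinates of `W`.
  obtain ⟨g, hg⟩ := Finset.exists_equiv_extend_of_card_eq (t := t) (by simp [htcard]) htl hinj
  set c : Fin ρ ↪ Fin N := g.toEmbedding.trans (Function.Embedding.subtype _) with hc
  have hcf : ∀ s, ((rows s).1 = i ∨ (rows s).1 = j) → c s = f s := fun s hs =>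
    hg s (Finset.mem_filter.2 ⟨Finset.mem_univ _, hs⟩)
  have hcW : ∀ s, (c s : ℕ) < r ∨ N - r ≤ (c s : ℕ) := fun s =>
    (Finset.mem_filter.1 (htr (g s).2)).2
  have hσ : ∀ l, ∃ σ : Fin r ↪ Fin N, (∀ s, (rows s).1 = l → c s ∉ Set.range σ) ∧
      (l = i → ∀ x : Fin N, (x : ℕ) < r → x ∈ Set.range σ) ∧
      (l = j → ∀ x : Fin N, N - r ≤ (x : ℕ) → x ∈ Set.range σ) := by
    intro l
    by_cases hli : l = i
    · refine ⟨Fin.castLEEmb hr.le, fun s hs => ?_, fun _ x hx => ⟨⟨x, hx⟩, rfl⟩,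
        fun hlj => absurd (hli.symm.trans hlj) hij⟩
      rintro ⟨k, hk⟩
      rw [hcf s (Or.inl (hs.trans hli))] at hk
      simp only [hf, if_pos (hs.trans hli)] at hk
      have hk' := congrArg Fin.val hk
      simp only [Fin.coe_castLEEmb, Fin.val_castLE] at hk'
      have := hlt' s
      have := k.2
      omega
    by_cases hlj : l = j
    · refine ⟨⟨fun k => ⟨N - r + k, by have := k.2; omega⟩, fun k k' h => ?_⟩, fun s hs => ?_,
        fun h => absurd h hli, fun _ x hx => ⟨⟨x - (N - r), by have := x.2; omega⟩, ?_⟩⟩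
      · simp only [Fin.mk.injEq] at h
        exact Fin.ext (by omega)
      · rintro ⟨k, hk⟩
        rw [hcf s (Or.inr (hs.trans hlj))] at hk
        simp only [hf, if_neg (fun h => hli (hs.symm.trans h))] at hk
        have hk' : N - r + (k : ℕ) = (rows s).2 := congrArg Fin.val hk
        have := hlt' s
        omega
      · exact Fin.ext (show N - r + ((x : ℕ) - (N - r)) = x by omega)
    -- For the remaining blocks the subspace adapts to the rows: at most `m l` coordinates are
    -- forbidden, leaving at least `r`.
    · have hcard : ((Finset.univ.filter fun s => (rows s).1 = l).image c).card ≤ m l := by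
        refine Finset.card_image_le.trans ?_
        have : ((Finset.univ.filter fun s => (rows s).1 = l)).card ≤ (Finset.range (m l)).card := by
          refine Finset.card_le_card_of_injOn (fun s => ((rows s).2 : ℕ)) (fun s hs => ?_)
            fun s hs t ht hst => ?_
          · have hs' := (Finset.mem_filter.1 (Finset.mem_coe.1 hs)).2
            simp only [Finset.coe_range, Set.mem_Iio]
            exact lt_of_lt_of_eq (rows s).2.2 (congrArg m hs')
          · have hs' := (Finset.mem_filter.1 (Finset.mem_coe.1 hs)).2
            have ht' := (Finset.mem_filter.1 (Finset.mem_coe.1 ht)).2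
            exact rows.injective (sigma_fin_ext (hs'.trans ht'.symm) hst)
        simpa using this
      obtain ⟨σ, hσ⟩ := exists_embedding_avoiding (r := r)
        ((Finset.univ.filter fun s => (rows s).1 = l).image c) (by have := hm l; omega)
      refine ⟨σ, fun s hs => ?_, fun h => absurd h hli, fun h => absurd h hlj⟩
      rintro ⟨k, hk⟩
      exact hσ k (hk ▸ Finset.mem_image.2 ⟨s, by simpa using hs, rfl⟩)
  choose σ hσ1 hσ2 hσ3 using hσ
  refine ⟨σ, rows, c, fun s => hσ1 _ s rfl, fun s => ?_⟩
  rcases hcW s with h | h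
  · exact Or.inl (hσ2 i rfl _ h)
  · exact Or.inr (hσ3 j rfl _ h)


/-! ### Zero sets of polynomial functions -/

section PolynomialOnLines

variable {E : Type*} [NormedAddCommGroup E] [NormedSpace ℝ E]

/-- A continuous function whose restriction to every line is a polynomial. -/
def PolynomialOnLines (f : E → ℝ) : Prop :=
  Continuous f ∧ ∀ x y, ∃ q : Polynomial ℝ, ∀ t : ℝ, f (x + t • y) = q.eval t

namespace PolynomialOnLines

variable {f g : E → ℝ}

theorem const (c : ℝ) : PolynomialOnLines fun _ : E => c :=
  ⟨continuous_const, fun _ _ => ⟨Polynomial.C c, fun _ => by simp⟩⟩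

theorem of_continuousLinearMap (f : E →L[ℝ] ℝ) : PolynomialOnLines fun x => f x :=
  ⟨f.continuous, fun x y => ⟨Polynomial.C (f x) + Polynomial.X * Polynomial.C (f y), fun t => by
    simp only [map_add, map_smul, smul_eq_mul, Polynomial.eval_add, Polynomial.eval_mul,
      Polynomial.eval_C, Polynomial.eval_X]⟩⟩

theorem add (hf : PolynomialOnLines f) (hg : PolynomialOnLines g) :
    PolynomialOnLines fun x => f x + g x :=
  ⟨hf.1.add hg.1, fun x y => by
    obtain ⟨p, hp⟩ := hf.2 x y
    obtain ⟨q, hq⟩ := hg.2 x y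
    exact ⟨p + q, fun t => by simp [hp, hq]⟩⟩

theorem mul (hf : PolynomialOnLines f) (hg : PolynomialOnLines g) :
    PolynomialOnLines fun x => f x * g x :=
  ⟨hf.1.mul hg.1, fun x y => by
    obtain ⟨p, hp⟩ := hf.2 x y
    obtain ⟨q, hq⟩ := hg.2 x y
    exact ⟨p * q, fun t => by simp [hp, hq]⟩⟩

theorem sub (hf : PolynomialOnLines f) (hg : PolynomialOnLines g) :
    PolynomialOnLines fun x => f x - g x := by
  simpa [sub_eq_add_neg] using hf.add ((const (-1)).mul hg)

theorem sum {ι : Type*} (s : Finset ι) {F : ι → E → ℝ} (hF : ∀ i, PolynomialOnLines (F i)) :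
    PolynomialOnLines fun x => ∑ i ∈ s, F i x :=
  ⟨continuous_finsetSum _ fun i _ => (hF i).1, fun x y => by
    choose q hq using fun i => (hF i).2 x y
    exact ⟨∑ i ∈ s, q i, fun t => by simp [hq, Polynomial.eval_finsetSum]⟩⟩

theorem prod {ι : Type*} (s : Finset ι) {F : ι → E → ℝ} (hF : ∀ i, PolynomialOnLines (F i)) :
    PolynomialOnLines fun x => ∏ i ∈ s, F i x :=
  ⟨continuous_finsetProd _ fun i _ => (hF i).1, fun x y => by
    choose q hq using fun i => (hF i).2 x y
    exact ⟨∏ i ∈ s, q i, fun t => by simp [hq, Polynomial.eval_prod]⟩⟩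

theorem det {n : Type*} [Fintype n] [DecidableEq n] {A : E → Matrix n n ℝ}
    (hA : ∀ i j, PolynomialOnLines fun x => A x i j) : PolynomialOnLines fun x => (A x).det := by
  simp only [Matrix.det_apply']
  exact sum _ fun σ => (const _).mul (prod _ fun i => hA _ _)

/-- An entry of the adjugate is the determinant of a matrix with one row replaced by a constant
vector. -/
theorem adjugate {n : Type*} [Fintype n] [DecidableEq n] {A : E → Matrix n n ℝ}
    (hA : ∀ i j, PolynomialOnLines fun x => A x i j) (i j : n) :
    PolynomialOnLines fun x => (A x).adjugate i j := by
  simp only [Matrix.adjugate_apply]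
  refine det fun k l => ?_
  by_cases h : k = j
  · subst h
    simpa using const _
  · simpa [Matrix.updateRow_ne h] using hA k l

theorem matrix_mul {l m n : Type*} [Fintype m] {A : E → Matrix l m ℝ} {B : E → Matrix m n ℝ}
    (hA : ∀ i j, PolynomialOnLines fun x => A x i j)
    (hB : ∀ i j, PolynomialOnLines fun x => B x i j) (i : l) (j : n) :
    PolynomialOnLines fun x => (A x * B x) i j := by
  simp only [Matrix.mul_apply]
  exact sum _ fun k => (hA i k).mul (hB k j)

/-- The zero set of a nonzero polynomial function is a null set. -/
theorem ae_ne_zero [FiniteDimensional ℝ E] [MeasurableSpace E] [BorelSpace E] (μ : Measure E)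
    [μ.IsAddHaarMeasure] (hf : PolynomialOnLines f) {x₀ : E} (h₀ : f x₀ ≠ 0) :
    ∀ᵐ x ∂μ, f x ≠ 0 := by
  have hm : MeasurableSet {q : E × ℝ | f (x₀ + q.2 • q.1) ≠ 0} := by
    have : Continuous fun q : E × ℝ => f (x₀ + q.2 • q.1) := hf.1.comp (by fun_prop)
    exact (this.measurable (measurableSet_singleton 0)).compl
  -- On every line through `x₀` the restriction is a nonzero polynomial, with finitely many roots.
  have h1 : ∀ᵐ y ∂μ, ∀ᵐ t ∂(volume : Measure ℝ), f (x₀ + t • y) ≠ 0 := by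
    refine Eventually.of_forall fun y => ?_
    obtain ⟨q, hq⟩ := hf.2 x₀ y
    have hq0 : q ≠ 0 := by
      rintro rfl
      apply h₀
      simpa using hq 0
    rw [ae_iff]
    refine Set.Countable.measure_zero (Set.Finite.countable ?_) _
    refine (q.roots.toFinset.finite_toSet).subset fun t ht => ?_
    simp only [ne_eq, not_not, Set.mem_ofPred_eq, hq] at ht
    simpa [hq0] using ht
  have h2 : ∀ᵐ t ∂(volume : Measure ℝ), ∀ᵐ y ∂μ, f (x₀ + t • y) ≠ 0 :=
    (Measure.ae_ae_comm (p := fun y t => f (x₀ + t • y) ≠ 0) hm).1 h1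
  -- After exchanging the quantifiers by Fubini, a single `t ≠ 0` suffices: `y ↦ x₀ + t • y` is an
  -- affine isomorphism, under which null sets correspond.
  obtain ⟨t, ht, ht0⟩ := (h2.and (Measure.ae_ne volume (0 : ℝ))).exists
  rw [ae_iff] at ht ⊢
  have hset : {y | ¬f (x₀ + t • y) ≠ 0} = (fun y => t • y) ⁻¹' ((fun y => x₀ + y) ⁻¹' {x | ¬f x ≠ 0}) :=
    rfl
  rw [hset, Measure.addHaar_preimage_smul μ ht0, measure_preimage_add, mul_eq_zero] at ht
  refine ht.resolve_left ?_
  simp [ht0]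

end PolynomialOnLines

end PolynomialOnLines


/-! ### Ranks of the projected covariances -/

section Rank

variable {ι : Type*} {N : ℕ}

/-- This permits replacing covariances by the orthogonal projections onto their images. -/
theorem rank_mul_le_of_range_le (Φ : Matrix ι (Fin N) ℝ) {X Y : Matrix (Fin N) (Fin N) ℝ}
    (h : LinearMap.range X.toEuclideanLin ≤ LinearMap.range Y.toEuclideanLin) :
    (Φ * X).rank ≤ (Φ * Y).rank := by
  have h' : LinearMap.range X.mulVecLin ≤ LinearMap.range Y.mulVecLin := by
    rintro _ ⟨w, rfl⟩
    obtain ⟨u, hu⟩ := h ⟨WithLp.toLp 2 w, rfl⟩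
    exact ⟨u.ofLp, congrArg WithLp.ofLp hu⟩
  rw [Matrix.rank, Matrix.rank, Matrix.mulVecLin_mul, Matrix.mulVecLin_mul, LinearMap.range_comp,
    LinearMap.range_comp]
  exact Submodule.finrank_mono (Submodule.map_mono h')

theorem rank_eq_finrank_range_toEuclideanLin (X : Matrix (Fin N) (Fin N) ℝ) :
    X.rank = Module.finrank ℝ (LinearMap.range X.toEuclideanLin) := by
  rw [X.rank_eq_finrank_range_toLin (PiLp.basisFun 2 ℝ (Fin N)) (PiLp.basisFun 2 ℝ (Fin N)),
    ← Matrix.toLpLin_eq_toLin]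

/-- On orthogonal complements: if `(A + B) x = 0`, the two nonnegative quadratic forms at `x` sum to
0, so both vanish and `A x = 0`. -/
theorem range_le_range_add {A B : Matrix (Fin N) (Fin N) ℝ} (hA : A.PosSemidef)
    (hB : B.PosSemidef) :
    LinearMap.range A.toEuclideanLin ≤ LinearMap.range (A + B).toEuclideanLin := by
  have hA' := (Matrix.isPositive_toEuclideanLin_iff.2 hA).1
  have hAB' := (Matrix.isPositive_toEuclideanLin_iff.2 (hA.add hB)).1
  rw [← Submodule.orthogonal_orthogonal (LinearMap.range (A + B).toEuclideanLin),
    ← Submodule.orthogonal_orthogonal (LinearMap.range A.toEuclideanLin)]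
  refine Submodule.orthogonal_le ?_
  rw [hA'.orthogonal_range, hAB'.orthogonal_range]
  intro x hx
  have hx' : (A + B).mulVec x.ofLp = 0 := congrArg WithLp.ofLp (LinearMap.mem_ker.1 hx)
  have h0 : x.ofLp ⬝ᵥ A.mulVec x.ofLp + x.ofLp ⬝ᵥ B.mulVec x.ofLp = 0 := by
    rw [← dotProduct_add, ← Matrix.add_mulVec, hx', dotProduct_zero]
  have hA0 : 0 ≤ x.ofLp ⬝ᵥ A.mulVec x.ofLp := by simpa using hA.dotProduct_mulVec_nonneg x.ofLp
  have hB0 : 0 ≤ x.ofLp ⬝ᵥ B.mulVec x.ofLp := by simpa using hB.dotProduct_mulVec_nonneg x.ofLp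
  have hz : A.mulVec x.ofLp = 0 := by
    refine (hA.dotProduct_mulVec_zero_iff x.ofLp).1 ?_
    simp only [star_trivial]
    linarith
  exact LinearMap.mem_ker.2 (congrArg (WithLp.toLp 2) hz)

-- With `S = Bᵀ B`, the left side is the Gram matrix of `Φ Bᵀ` and has the same rank as `Φ Bᵀ`,
-- while `Φ S` factors through `Φ Bᵀ`.
open scoped MatrixOrder in
theorem rank_mul_mul_transpose [Fintype ι] (Φ : Matrix ι (Fin N) ℝ) {S : Matrix (Fin N) (Fin N) ℝ}
    (hS : S.PosSemidef) : (Φ * S * Φ.transpose).rank = (Φ * S).rank := by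
  classical
  refine le_antisymm (Matrix.rank_mul_le_left _ _) ?_
  have hBpos : (CFC.sqrt S).PosSemidef := (Matrix.nonneg_iff_posSemidef).1 (CFC.sqrt_nonneg S)
  obtain ⟨B, hB⟩ : ∃ B : Matrix (Fin N) (Fin N) ℝ, S = B.transpose * B :=
    ⟨CFC.sqrt S, by
      rw [show (CFC.sqrt S).transpose = CFC.sqrt S from hBpos.1,
        CFC.sqrt_mul_sqrt_self S hS.nonneg]⟩
  have h1 : Φ * S * Φ.transpose = (Φ * B.transpose) * (Φ * B.transpose).transpose := by
    rw [hB, Matrix.transpose_mul, Matrix.transpose_transpose]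
    simp only [Matrix.mul_assoc]
  rw [h1, Matrix.rank_self_mul_transpose, hB, ← Matrix.mul_assoc]
  exact Matrix.rank_mul_le_left _ _

end Rank

/-! ### Measurement blocks orthogonal to the subspaces -/

section Blocks

variable {L N r : ℕ} {m : Fin L → ℕ}

/-- The matrix of the orthogonal projection onto `V`. -/
noncomputable def projMatrix (V : Grassmannian N r) : Matrix (Fin N) (Fin N) ℝ := Matrix.of V.proj

theorem toEuclideanLin_projMatrix (V : Grassmannian N r) (x : EuclideanSpace ℝ (Fin N)) :
    (projMatrix V).toEuclideanLin x = V.1.starProjection x := by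
  have : (projMatrix V).toEuclideanLin = (V.1.starProjection : _ →ₗ[ℝ] _) := by
    refine (EuclideanSpace.basisFun (Fin N) ℝ).toBasis.ext fun j => ?_
    ext i
    simp [projMatrix, Grassmannian.proj, Matrix.toLpLin_apply]
  rw [this]
  rfl

theorem range_projMatrix (V : Grassmannian N r) :
    LinearMap.range (projMatrix V).toEuclideanLin = V.1 := by
  ext x
  simp only [LinearMap.mem_range, toEuclideanLin_projMatrix]
  constructor
  · rintro ⟨y, rfl⟩
    exact Submodule.starProjection_apply_mem _ _
  · exact fun hx => ⟨x, Submodule.starProjection_eq_self_iff.2 hx⟩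

theorem posSemidef_projMatrix (V : Grassmannian N r) : (projMatrix V).PosSemidef := by
  rw [← Matrix.isPositive_toEuclideanLin_iff]
  have : (projMatrix V).toEuclideanLin = (V.1.starProjection : _ →ₗ[ℝ] _) :=
    LinearMap.ext (toEuclideanLin_projMatrix V)
  rw [this]
  exact (ContinuousLinearMap.IsStarProjection.isSymmetricProjection
    isStarProjection_starProjection).isPositive

/-- The matrix whose rows in the block `l` are the components of the vectors `z` orthogonal to the
subspace `P l`. -/
noncomputable def blockMatrix (P : Fin L → Grassmannian N r)
    (z : (l : Fin L) × Fin (m l) → EuclideanSpace ℝ (Fin N)) :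
    Matrix ((l : Fin L) × Fin (m l)) (Fin N) ℝ :=
  Matrix.of fun q x => z q x - ∑ y, (P q.1).proj x y * z q y

theorem blockMatrix_row (P : Fin L → Grassmannian N r)
    (z : (l : Fin L) × Fin (m l) → EuclideanSpace ℝ (Fin N)) (q : (l : Fin L) × Fin (m l)) :
    blockMatrix P z q = (z q - (P q.1).1.starProjection (z q)).ofLp := by
  ext x
  rw [← toEuclideanLin_projMatrix]
  simp [blockMatrix, projMatrix, Matrix.toLpLin_apply, Matrix.mulVec, dotProduct]

/-- The rows of the block `l` do not see covariances supported on the subspace `P l`. -/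
theorem blockMatrix_mul_row_eq_zero (P : Fin L → Grassmannian N r)
    (z : (l : Fin L) × Fin (m l) → EuclideanSpace ℝ (Fin N)) {S : Matrix (Fin N) (Fin N) ℝ}
    {q : (l : Fin L) × Fin (m l)} (hS : LinearMap.range S.toEuclideanLin = (P q.1).1) :
    (blockMatrix P z * S) q = 0 := by
  ext y
  have hmem : S.toEuclideanLin (EuclideanSpace.single y 1) ∈ (P q.1).1 := hS ▸ ⟨_, rfl⟩
  have h := Submodule.starProjection_inner_eq_zero (K := (P q.1).1) (z q) _ hmem
  rw [EuclideanSpace.inner_eq_star_dotProduct, star_trivial, ← blockMatrix_row, dotProduct_comm] at h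
  simpa [Matrix.mul_apply, Matrix.toLpLin_apply, dotProduct] using h

/-- The `m i` rows of block `i` vanish after multiplication by `S`, so the remaining rows span the
row space. -/
theorem rank_blockMatrix_mul_add_le (P : Fin L → Grassmannian N r)
    (z : (l : Fin L) × Fin (m l) → EuclideanSpace ℝ (Fin N)) {S : Matrix (Fin N) (Fin N) ℝ}
    {i : Fin L} (hS : LinearMap.range S.toEuclideanLin = (P i).1) :
    (blockMatrix P z * S).rank + m i ≤ ∑ l, m l := by
  classical
  set T : Finset ((l : Fin L) × Fin (m l)) :=
    (Finset.univ.erase i).sigma fun l => Finset.univ with hT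
  have hTcard : T.card + m i = ∑ l, m l := by
    rw [hT, Finset.card_sigma, ← Finset.add_sum_erase _ _ (Finset.mem_univ i)]
    simp [add_comm]
  have hle : (blockMatrix P z * S).rank ≤ T.card := by
    rw [Matrix.rank_eq_finrank_span_row]
    have hspan : Submodule.span ℝ (Set.range (blockMatrix P z * S).row) ≤
        Submodule.span ℝ ((T.image (blockMatrix P z * S).row : Finset _) : Set (Fin N → ℝ)) := by
      refine Submodule.span_le.2 ?_
      rintro _ ⟨q, rfl⟩
      by_cases hq : q.1 = i
      · have : (blockMatrix P z * S).row q = 0 := blockMatrix_mul_row_eq_zero P z (hq ▸ hS)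
        rw [this]
        exact Submodule.zero_mem _
      · refine Submodule.subset_span (Finset.mem_coe.2 (Finset.mem_image_of_mem _ ?_))
        simp [hT, hq]
    exact (Submodule.finrank_mono hspan).trans
      ((finrank_span_finset_le_card _).trans Finset.card_image_le)
  omega

end Blocks


/-! ### Generic frames -/

section Frames

variable {L N r : ℕ} {m : Fin L → ℕ}

/-- The matrix with the vectors of a frame as columns. -/
def frameMatrix (a : Fin r → EuclideanSpace ℝ (Fin N)) : Matrix (Fin N) (Fin r) ℝ :=
  Matrix.of fun x k => a k x

/-- The determinant of the Gram matrix of a frame. -/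
noncomputable def gramDet (a : Fin r → EuclideanSpace ℝ (Fin N)) : ℝ :=
  ((frameMatrix a).transpose * frameMatrix a).det

/-- The polynomial multiple `gramDet a • P` of the projection `P` onto the span of the frame. -/
noncomputable def scaledProj (a : Fin r → EuclideanSpace ℝ (Fin N)) : Matrix (Fin N) (Fin N) ℝ :=
  frameMatrix a * ((frameMatrix a).transpose * frameMatrix a).adjugate * (frameMatrix a).transpose

/-- A matrix, polynomial in the frames, whose rows are multiples of those of `blockMatrix`. -/
noncomputable def scaledBlockMatrix (a : Fin L → Fin r → EuclideanSpace ℝ (Fin N))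
    (z : (l : Fin L) × Fin (m l) → EuclideanSpace ℝ (Fin N)) :
    Matrix ((l : Fin L) × Fin (m l)) (Fin N) ℝ :=
  Matrix.of fun q x => gramDet (a q.1) * z q x - ∑ y, scaledProj (a q.1) x y * z q y

/-- A polynomial whose nonvanishing expresses that the subspaces and the rows are generic. -/
noncomputable def genericityTest {ρ : ℕ} (i j : Fin L) (rows : Fin ρ → (l : Fin L) × Fin (m l))
    (cols : Fin ρ → Fin N)
    (q : (Fin L → Fin r → EuclideanSpace ℝ (Fin N)) ×
      ((l : Fin L) × Fin (m l) → EuclideanSpace ℝ (Fin N))) : ℝ :=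
  ((scaledBlockMatrix q.1 q.2 * (frameMatrix (q.1 i) * (frameMatrix (q.1 i)).transpose +
    frameMatrix (q.1 j) * (frameMatrix (q.1 j)).transpose)).submatrix rows cols).det *
    ∏ l, gramDet (q.1 l)

theorem gram_eq (a : Fin r → EuclideanSpace ℝ (Fin N)) :
    Matrix.gram ℝ a = (frameMatrix a).transpose * frameMatrix a := by
  ext k l
  simp [Matrix.gram_apply, frameMatrix, Matrix.mul_apply, PiLp.inner_apply, mul_comm]

theorem linearIndependent_of_gramDet_ne_zero {a : Fin r → EuclideanSpace ℝ (Fin N)}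
    (h : gramDet a ≠ 0) : LinearIndependent ℝ a := by
  rw [gramDet, ← gram_eq] at h
  exact Matrix.det_gram_ne_zero_iff_linearIndependent.1 h

theorem frameMatrix_mulVec_mem_span (a : Fin r → EuclideanSpace ℝ (Fin N)) (w : Fin r → ℝ) :
    WithLp.toLp 2 ((frameMatrix a).mulVec w) ∈ Submodule.span ℝ (Set.range a) := by
  have : WithLp.toLp 2 ((frameMatrix a).mulVec w) = ∑ k, w k • a k := by
    ext x
    simp [frameMatrix, Matrix.mulVec, dotProduct, mul_comm]
  rw [this]
  exact Submodule.sum_mem _ fun k _ => Submodule.smul_mem _ _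
    (Submodule.subset_span (Set.mem_range_self k))

/-- The projection is `F (Fᵀ F)⁻¹ Fᵀ` for the frame matrix `F`; the adjugate clears the denominator,
which keeps the genericity condition polynomial. -/
theorem scaledProj_eq_smul {a : Fin r → EuclideanSpace ℝ (Fin N)} (h : gramDet a ≠ 0)
    {V : Grassmannian N r} (hV : V.1 = Submodule.span ℝ (Set.range a)) :
    scaledProj a = gramDet a • projMatrix V := by
  have key : ∀ x : EuclideanSpace ℝ (Fin N), (projMatrix V).toEuclideanLin x =
      (gramDet a)⁻¹ • (scaledProj a).toEuclideanLin x := by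
    intro x
    rw [toEuclideanLin_projMatrix]
    refine Submodule.eq_starProjection_of_mem_of_inner_eq_zero ?_ ?_
    · rw [hV]
      refine Submodule.smul_mem _ _ ?_
      rw [Matrix.toLpLin_apply, scaledProj, Matrix.mul_assoc, ← Matrix.mulVec_mulVec]
      exact frameMatrix_mulVec_mem_span a _
    · intro w hw
      rw [hV] at hw
      induction hw using Submodule.span_induction with
      | mem w hw =>
        obtain ⟨k, rfl⟩ := hw
        have h1 : (frameMatrix a).transpose.mulVec ((scaledProj a).mulVec x.ofLp) =
            gramDet a • (frameMatrix a).transpose.mulVec x.ofLp := by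
          rw [Matrix.mulVec_mulVec, scaledProj, ← Matrix.mul_assoc, ← Matrix.mul_assoc, Matrix.mul_adjugate,
            Matrix.smul_mul, Matrix.one_mul, Matrix.smul_mulVec, gramDet]
        have h2 : ∀ u : EuclideanSpace ℝ (Fin N),
            inner ℝ u (a k) = (frameMatrix a).transpose.mulVec u.ofLp k := by
          intro u
          simp [frameMatrix, Matrix.mulVec, dotProduct, PiLp.inner_apply]
        rw [inner_sub_left, inner_smul_left, h2, h2, Matrix.toLpLin_apply]
        simp only [conj_trivial]
        rw [h1]
        simp [h]
      | zero => simp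
      | add x y _ _ hx hy => rw [inner_add_right, hx, hy, add_zero]
      | smul c x _ hx => rw [inner_smul_right, hx, mul_zero]
  refine Matrix.toEuclideanLin.injective (LinearMap.ext fun x => ?_)
  rw [map_smul, LinearMap.smul_apply, key, smul_smul, mul_inv_cancel₀ h, one_smul]

theorem scaledBlockMatrix_eq_diagonal_mul {a : Fin L → Fin r → EuclideanSpace ℝ (Fin N)}
    (h : ∀ l, gramDet (a l) ≠ 0) {P : Fin L → Grassmannian N r}
    (hP : ∀ l, (P l).1 = Submodule.span ℝ (Set.range (a l)))
    (z : (l : Fin L) × Fin (m l) → EuclideanSpace ℝ (Fin N)) :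
    scaledBlockMatrix a z =
      Matrix.diagonal (fun q : (l : Fin L) × Fin (m l) => gramDet (a q.1)) * blockMatrix P z := by
  ext q x
  rw [Matrix.diagonal_mul]
  simp only [scaledBlockMatrix, blockMatrix, Matrix.of_apply, scaledProj_eq_smul (h _) (hP _),
    Matrix.smul_apply, smul_eq_mul, projMatrix, mul_sub, Finset.mul_sum, mul_assoc]

theorem range_frameMatrix_mul_transpose_add_le {a : Fin L → Fin r → EuclideanSpace ℝ (Fin N)}
    {P : Fin L → Grassmannian N r} (hP : ∀ l, (P l).1 = Submodule.span ℝ (Set.range (a l)))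
    (i j : Fin L) :
    LinearMap.range (frameMatrix (a i) * (frameMatrix (a i)).transpose +
      frameMatrix (a j) * (frameMatrix (a j)).transpose).toEuclideanLin ≤
      LinearMap.range (projMatrix (P i) + projMatrix (P j)).toEuclideanLin := by
  have hi := range_le_range_add (posSemidef_projMatrix (P i)) (posSemidef_projMatrix (P j))
  have hj := range_le_range_add (posSemidef_projMatrix (P j)) (posSemidef_projMatrix (P i))
  rw [add_comm (projMatrix (P j)), range_projMatrix] at hj
  rw [range_projMatrix] at hi
  have hl : ∀ l (x : EuclideanSpace ℝ (Fin N)),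
      (frameMatrix (a l) * (frameMatrix (a l)).transpose).toEuclideanLin x ∈ (P l).1 := by
    intro l x
    rw [hP, Matrix.toLpLin_apply, ← Matrix.mulVec_mulVec]
    exact frameMatrix_mulVec_mem_span _ _
  rintro _ ⟨x, rfl⟩
  rw [map_add Matrix.toEuclideanLin (frameMatrix (a i) * _), LinearMap.add_apply]
  exact Submodule.add_mem _ (hi (hl i x)) (hj (hl j x))

theorem le_rank_of_det_submatrix_ne_zero {ι κ : Type*} [Fintype ι] [Fintype κ] {ρ : ℕ}
    {A : Matrix ι κ ℝ} {rows : Fin ρ → ι} {cols : Fin ρ → κ}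
    (h : (A.submatrix rows cols).det ≠ 0) : ρ ≤ A.rank := by
  have h1 := Matrix.rank_of_isUnit _ ((Matrix.isUnit_iff_isUnit_det _).2 (isUnit_iff_ne_zero.2 h))
  rw [Fintype.card_fin] at h1
  rw [← h1]
  exact Matrix.rank_submatrix_le _ _ _

/-- The first factor of the test is a minor of size `ρ`; the second makes the frames independent.
Only upper bounds for this minor's rank by that of the unscaled product are needed, so one-sided
inclusions of images suffice. -/
theorem le_rank_of_genericityTest_ne_zero {ρ : ℕ} {i j : Fin L}
    {rows : Fin ρ → (l : Fin L) × Fin (m l)} {cols : Fin ρ → Fin N}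
    {a : Fin L → Fin r → EuclideanSpace ℝ (Fin N)}
    {z : (l : Fin L) × Fin (m l) → EuclideanSpace ℝ (Fin N)}
    (h : genericityTest i j rows cols (a, z) ≠ 0) {P : Fin L → Grassmannian N r}
    (hP : ∀ l, (P l).1 = Submodule.span ℝ (Set.range (a l))) :
    ρ ≤ (blockMatrix P z * (projMatrix (P i) + projMatrix (P j))).rank := by
  have hg : ∀ l, gramDet (a l) ≠ 0 := fun l =>
    (Finset.prod_ne_zero_iff.1 (right_ne_zero_of_mul h)) l (Finset.mem_univ l)
  refine (le_rank_of_det_submatrix_ne_zero (left_ne_zero_of_mul h)).trans ?_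
  rw [scaledBlockMatrix_eq_diagonal_mul hg hP, Matrix.mul_assoc]
  exact (Matrix.rank_mul_le_right _ _).trans
    (rank_mul_le_of_range_le _ (range_frameMatrix_mul_transpose_add_le hP i j))

theorem polynomialOnLines_genericityTest {ρ : ℕ} (i j : Fin L)
    (rows : Fin ρ → (l : Fin L) × Fin (m l)) (cols : Fin ρ → Fin N) :
    PolynomialOnLines (genericityTest (r := r) i j rows cols) := by
  have ha : ∀ (l : Fin L) (x : Fin N) (k : Fin r), PolynomialOnLines
      fun q : (Fin L → Fin r → EuclideanSpace ℝ (Fin N)) ×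
        ((l : Fin L) × Fin (m l) → EuclideanSpace ℝ (Fin N)) => frameMatrix (q.1 l) x k :=
    fun l x k => PolynomialOnLines.of_continuousLinearMap
      ((EuclideanSpace.proj (𝕜 := ℝ) x).comp
        ((ContinuousLinearMap.proj (R := ℝ) (φ := fun _ : Fin r => EuclideanSpace ℝ (Fin N)) k).comp
        ((ContinuousLinearMap.proj (R := ℝ)
          (φ := fun _ : Fin L => Fin r → EuclideanSpace ℝ (Fin N)) l).comp
          (ContinuousLinearMap.fst ℝ (Fin L → Fin r → EuclideanSpace ℝ (Fin N))
            ((l : Fin L) × Fin (m l) → EuclideanSpace ℝ (Fin N))))))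
  have hz : ∀ (s : (l : Fin L) × Fin (m l)) (x : Fin N), PolynomialOnLines
      fun q : (Fin L → Fin r → EuclideanSpace ℝ (Fin N)) ×
        ((l : Fin L) × Fin (m l) → EuclideanSpace ℝ (Fin N)) => q.2 s x :=
    fun s x => PolynomialOnLines.of_continuousLinearMap
      ((EuclideanSpace.proj (𝕜 := ℝ) x).comp
        ((ContinuousLinearMap.proj (R := ℝ)
          (φ := fun _ : (l : Fin L) × Fin (m l) => EuclideanSpace ℝ (Fin N)) s).comp
          (ContinuousLinearMap.snd ℝ (Fin L → Fin r → EuclideanSpace ℝ (Fin N))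
            ((l : Fin L) × Fin (m l) → EuclideanSpace ℝ (Fin N)))))
  have hG : ∀ (l : Fin L) (k k' : Fin r), PolynomialOnLines
      fun q : (Fin L → Fin r → EuclideanSpace ℝ (Fin N)) ×
        ((l : Fin L) × Fin (m l) → EuclideanSpace ℝ (Fin N)) =>
        ((frameMatrix (q.1 l)).transpose * frameMatrix (q.1 l)) k k' := fun l =>
    PolynomialOnLines.matrix_mul (fun k x => ha l x k) (ha l)
  have hdet : ∀ l : Fin L, PolynomialOnLines
      fun q : (Fin L → Fin r → EuclideanSpace ℝ (Fin N)) ×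
        ((l : Fin L) × Fin (m l) → EuclideanSpace ℝ (Fin N)) => gramDet (q.1 l) := fun l =>
    PolynomialOnLines.det (hG l)
  have hproj : ∀ (l : Fin L) (x y : Fin N), PolynomialOnLines
      fun q : (Fin L → Fin r → EuclideanSpace ℝ (Fin N)) ×
        ((l : Fin L) × Fin (m l) → EuclideanSpace ℝ (Fin N)) => scaledProj (q.1 l) x y := fun l =>
    PolynomialOnLines.matrix_mul (PolynomialOnLines.matrix_mul (ha l)
      (PolynomialOnLines.adjugate (hG l))) fun k x => ha l x k
  have hblock : ∀ (s : (l : Fin L) × Fin (m l)) (x : Fin N), PolynomialOnLines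
      fun q : (Fin L → Fin r → EuclideanSpace ℝ (Fin N)) ×
        ((l : Fin L) × Fin (m l) → EuclideanSpace ℝ (Fin N)) =>
        scaledBlockMatrix q.1 q.2 s x := fun s x =>
    ((hdet s.1).mul (hz s x)).sub (PolynomialOnLines.sum _ fun y => (hproj s.1 x y).mul (hz s y))
  have hW : ∀ (l : Fin L) (x y : Fin N), PolynomialOnLines
      fun q : (Fin L → Fin r → EuclideanSpace ℝ (Fin N)) ×
        ((l : Fin L) × Fin (m l) → EuclideanSpace ℝ (Fin N)) =>
        (frameMatrix (q.1 l) * (frameMatrix (q.1 l)).transpose) x y := fun l =>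
    PolynomialOnLines.matrix_mul (ha l) fun k x => ha l x k
  exact (PolynomialOnLines.det fun s t => PolynomialOnLines.matrix_mul hblock
    (fun x y => (hW i x y).add (hW j x y)) (rows s) (cols t)).mul
    (PolynomialOnLines.prod _ hdet)

/-- The frame of the coordinate vectors `e_{σ k}`. -/
noncomputable def coordinateFrame (σ : Fin r ↪ Fin N) : Fin r → EuclideanSpace ℝ (Fin N) :=
  fun k => EuclideanSpace.single (σ k) 1

theorem transpose_mul_frameMatrix_coordinateFrame (σ : Fin r ↪ Fin N) :
    (frameMatrix (coordinateFrame σ)).transpose * frameMatrix (coordinateFrame σ) = 1 := by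
  ext k k'
  simp [frameMatrix, coordinateFrame, Matrix.mul_apply, Matrix.one_apply, eq_comm]

open scoped Classical in
theorem frameMatrix_coordinateFrame_mul_transpose (σ : Fin r ↪ Fin N) :
    frameMatrix (coordinateFrame σ) * (frameMatrix (coordinateFrame σ)).transpose =
      Matrix.diagonal fun x => if x ∈ Set.range σ then 1 else 0 := by
  ext x y
  simp only [frameMatrix, coordinateFrame, Matrix.mul_apply, Matrix.of_apply,
    Matrix.transpose_apply, PiLp.single_apply, mul_ite, mul_one, mul_zero,
    Matrix.diagonal_apply, Set.mem_range]
  by_cases hxy : x = y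
  · subst hxy
    rw [if_pos rfl]
    by_cases hx : ∃ k, σ k = x
    · obtain ⟨k, rfl⟩ := hx
      rw [if_pos ⟨k, rfl⟩, Finset.sum_eq_single k]
      · simp
      · intro k' _ hk'
        rw [if_neg (fun h => hk' (σ.injective h).symm)]
      · simp
    · rw [if_neg hx]
      refine Finset.sum_eq_zero fun k _ => ?_
      rw [if_neg (fun h => hx ⟨k, h.symm⟩)]
  · rw [if_neg hxy]
    refine Finset.sum_eq_zero fun k _ => ?_
    split_ifs with h h'
    · exact absurd (h'.trans h.symm) hxy
    · rfl
    · rfl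

theorem exists_genericityTest_ne_zero {ρ : ℕ} (hr : r < N)
    (hm : ∀ l, m l + r ≤ N) {i j : Fin L} (hij : i ≠ j)
    (h0 : ρ ≤ N) (h1 : ρ ≤ 2 * r) (h2 : ρ ≤ ∑ l, m l) (h3 : ρ + m i ≤ ∑ l, m l + r)
    (h4 : ρ + m j ≤ ∑ l, m l + r) :
    ∃ (rows : Fin ρ → (l : Fin L) × Fin (m l)) (cols : Fin ρ → Fin N)
      (q : (Fin L → Fin r → EuclideanSpace ℝ (Fin N)) ×
        ((l : Fin L) × Fin (m l) → EuclideanSpace ℝ (Fin N))),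
      genericityTest i j rows cols q ≠ 0 := by
  classical
  obtain ⟨σ, rows, c, hc1, hc2⟩ := exists_coordinate_design hr hm hij h0 h1 h2 h3 h4
  set a : Fin L → Fin r → EuclideanSpace ℝ (Fin N) := fun l => coordinateFrame (σ l) with ha
  -- The selected rows are coordinate vectors; the value 0 on the others is immaterial, as the minor
  -- does not involve them.
  set z : (l : Fin L) × Fin (m l) → EuclideanSpace ℝ (Fin N) :=
    Function.extend rows (fun s => EuclideanSpace.single (c s) 1) 0 with hz
  have hdet : ∀ l, gramDet (a l) = 1 := fun l => by
    rw [gramDet, transpose_mul_frameMatrix_coordinateFrame, Matrix.det_one]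
  have hproj : ∀ l, scaledProj (a l) =
      Matrix.diagonal fun x => if x ∈ Set.range (σ l) then 1 else 0 := fun l => by
    rw [scaledProj, transpose_mul_frameMatrix_coordinateFrame, Matrix.adjugate_one,
      Matrix.mul_one, frameMatrix_coordinateFrame_mul_transpose]
  have hzs : ∀ s, z (rows s) = EuclideanSpace.single (c s) 1 := fun s =>
    rows.injective.extend_apply _ _ s
  have hrow : ∀ s x, scaledBlockMatrix a z (rows s) x = if x = c s then 1 else 0 := by
    intro s x
    simp only [scaledBlockMatrix, Matrix.of_apply, hdet, one_mul, hproj, hzs,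
      PiLp.single_apply, Matrix.diagonal_apply, mul_ite, mul_one, mul_zero,
      Finset.sum_ite_eq', Finset.mem_univ, if_true]
    by_cases hx : x = c s
    · subst hx
      simp [hc1 s]
    · simp [hx]
  refine ⟨rows, c, (a, z), ?_⟩
  rw [genericityTest]
  simp only [hdet, Finset.prod_const_one, mul_one]
  have hW : ∀ l, frameMatrix (a l) * (frameMatrix (a l)).transpose =
      Matrix.diagonal fun x => if x ∈ Set.range (σ l) then 1 else 0 := fun l =>
    frameMatrix_coordinateFrame_mul_transpose (σ l)
  rw [hW, hW, Matrix.diagonal_add]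
  have hdiag : (scaledBlockMatrix a z * Matrix.diagonal fun x =>
      (if x ∈ Set.range (σ i) then (1 : ℝ) else 0) + if x ∈ Set.range (σ j) then 1 else 0).submatrix
        rows c = Matrix.diagonal fun s => (if c s ∈ Set.range (σ i) then (1 : ℝ) else 0) +
          if c s ∈ Set.range (σ j) then 1 else 0 := by
    ext s t
    rw [Matrix.submatrix_apply, Matrix.mul_diagonal, hrow, Matrix.diagonal_apply]
    by_cases hst : s = t
    · subst hst
      simp
    · rw [if_neg hst, if_neg (fun h => hst (c.injective h).symm), zero_mul]
  -- Each diagonal entry counts which of the two subspaces contain `c s`, so it is 1 or 2.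
  rw [hdiag, Matrix.det_diagonal]
  refine Finset.prod_ne_zero_iff.2 fun s _ => ?_
  rcases hc2 s with h | h
  · rw [if_pos h]
    split_ifs <;> norm_num
  · rw [if_pos h]
    split_ifs <;> norm_num

/-- Almost all frames and rows are generic. -/
theorem ae_le_rank_blockMatrix_mul {ρ : ℕ} (hr : r < N)
    (hm : ∀ l, m l + r ≤ N) {i j : Fin L} (hij : i ≠ j)
    (h0 : ρ ≤ N) (h1 : ρ ≤ 2 * r) (h2 : ρ ≤ ∑ l, m l) (h3 : ρ + m i ≤ ∑ l, m l + r)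
    (h4 : ρ + m j ≤ ∑ l, m l + r) :
    ∀ᵐ q ∂(volume : Measure (Fin L → Fin r → EuclideanSpace ℝ (Fin N))).prod
        (volume : Measure ((l : Fin L) × Fin (m l) → EuclideanSpace ℝ (Fin N))),
      (∀ l, LinearIndependent ℝ (q.1 l)) ∧ ∀ P : Fin L → Grassmannian N r,
        (∀ l, (P l).1 = Submodule.span ℝ (Set.range (q.1 l))) →
        ρ ≤ (blockMatrix P q.2 * (projMatrix (P i) + projMatrix (P j))).rank := by
  obtain ⟨rows, cols, q₀, hq₀⟩ := exists_genericityTest_ne_zero hr hm hij h0 h1 h2 h3 h4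
  have : (volume : Measure (Fin r → EuclideanSpace ℝ (Fin N))).IsAddHaarMeasure :=
    Measure.pi.isAddHaarMeasure _
  have : (volume : Measure (Fin L → Fin r → EuclideanSpace ℝ (Fin N))).IsAddHaarMeasure :=
    Measure.pi.isAddHaarMeasure _
  have : (volume : Measure ((l : Fin L) × Fin (m l) →
      EuclideanSpace ℝ (Fin N))).IsAddHaarMeasure :=
    Measure.pi.isAddHaarMeasure _
  have : ((volume : Measure (Fin L → Fin r → EuclideanSpace ℝ (Fin N))).prod
      (volume : Measure ((l : Fin L) × Fin (m l) →
        EuclideanSpace ℝ (Fin N)))).IsAddHaarMeasure :=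
    Measure.prod.instIsAddHaarMeasure _ _
  filter_upwards [(polynomialOnLines_genericityTest i j rows cols).ae_ne_zero
    (Measure.prod volume volume) hq₀] with q hq
  refine ⟨fun l => linearIndependent_of_gramDet_ne_zero ?_, fun P hP =>
    le_rank_of_genericityTest_ne_zero hq hP⟩
  exact (Finset.prod_ne_zero_iff.1 (right_ne_zero_of_mul hq)) l (Finset.mem_univ l)

end Frames


/-! ### Generic subspaces -/

theorem pi_absolutelyContinuous {α : Type*} [MeasurableSpace α] :
    ∀ {n : ℕ} {μ ν : Fin n → Measure α} [∀ i, SigmaFinite (μ i)] [∀ i, SigmaFinite (ν i)],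
      (∀ i, μ i ≪ ν i) → Measure.pi μ ≪ Measure.pi ν
  | 0, μ, ν, _, _, _ => by
    rw [Measure.pi_of_empty μ Fin.elim0, Measure.pi_of_empty ν Fin.elim0]
  | n + 1, μ, ν, _, _, h => by
    have e₁ := (measurePreserving_piFinSuccAbove μ 0).symm
    have e₂ := (measurePreserving_piFinSuccAbove ν 0).symm
    rw [← e₁.map_eq, ← e₂.map_eq]
    exact ((h 0).prod (pi_absolutelyContinuous fun j => h ((0 : Fin (n + 1)).succAbove j))).map
      e₁.measurable

section Measurability

variable {L N r : ℕ} {m : Fin L → ℕ}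

/-- Lower semicontinuity of the rank. It makes the set of good pairs of subspaces and rows
measurable, as needed to transfer null sets between laws. -/
theorem isOpen_setOf_le_rank {ι κ : Type*} [Fintype ι] [Fintype κ] (n : ℕ) :
    IsOpen {X : ι → κ → ℝ | n ≤ (Matrix.of X).rank} := by
  classical
  have hc : Continuous fun X : ι → κ → ℝ =>
      LinearMap.toContinuousLinearMap (Matrix.of X).mulVecLin :=
    (LinearMap.continuous_of_finiteDimensional
      ((LinearMap.toContinuousLinearMap : ((κ → ℝ) →ₗ[ℝ] (ι → ℝ)) ≃ₗ[ℝ] _).toLinearMap ∘ₗ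
        (Matrix.toLin' : Matrix ι κ ℝ ≃ₗ[ℝ] _).toLinearMap ∘ₗ
          (Matrix.ofLinearEquiv ℝ).toLinearMap))
  convert (isOpen_setOfPred_nat_le_rank (𝕜 := ℝ) (E := κ → ℝ) (F := ι → ℝ) n).preimage hc using 1
  ext X
  simp only [Set.mem_preimage, Set.mem_ofPred_eq, LinearMap.coe_toContinuousLinearMap,
    LinearMap.rank, Matrix.rank, ← Module.finrank_eq_rank, Nat.cast_le]
  rfl

theorem measurable_proj_apply (x y : Fin N) :
    Measurable fun V : Grassmannian N r => V.proj x y :=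
  (measurable_pi_apply y).comp ((measurable_pi_apply x).comp
    (comap_measurable (Grassmannian.proj (N := N) (r := r))))

theorem measurableSet_le_rank_blockMatrix_mul (i j : Fin L) (n : ℕ) :
    MeasurableSet {q : (Fin L → Grassmannian N r) ×
      ((l : Fin L) × Fin (m l) → EuclideanSpace ℝ (Fin N)) |
      n ≤ (blockMatrix q.1 q.2 * (projMatrix (q.1 i) + projMatrix (q.1 j))).rank} := by
  have hP : ∀ (l : Fin L) (x y : Fin N), Measurable fun q : (Fin L → Grassmannian N r) ×
      ((l : Fin L) × Fin (m l) → EuclideanSpace ℝ (Fin N)) => (q.1 l).proj x y := fun l x y =>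
    (measurable_proj_apply x y).comp ((measurable_pi_apply l).comp measurable_fst)
  have hz : ∀ (s : (l : Fin L) × Fin (m l)) (x : Fin N), Measurable
      fun q : (Fin L → Grassmannian N r) ×
        ((l : Fin L) × Fin (m l) → EuclideanSpace ℝ (Fin N)) => q.2 s x := fun s x =>
    (EuclideanSpace.proj (𝕜 := ℝ) x).continuous.measurable.comp
      ((measurable_pi_apply s).comp measurable_snd)
  have hmeas : Measurable fun q : (Fin L → Grassmannian N r) ×
      ((l : Fin L) × Fin (m l) → EuclideanSpace ℝ (Fin N)) =>
      fun s x => (blockMatrix q.1 q.2 * (projMatrix (q.1 i) + projMatrix (q.1 j))) s x := by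
    refine measurable_pi_lambda _ fun s => measurable_pi_lambda _ fun x => ?_
    simp only [Matrix.mul_apply, blockMatrix, projMatrix, Matrix.of_apply, Matrix.add_apply]
    exact Finset.measurable_fun_sum _ fun y _ => ((hz s y).sub
      (Finset.measurable_fun_sum _ fun w _ => (hP s.1 y w).mul (hz s w))).mul
        ((hP i y x).add (hP j y x))
  exact hmeas (isOpen_setOf_le_rank n).measurableSet

/-- The uniform measure is absolutely continuous with respect to a measurable image of the law of a
Gaussian frame which is the span on linearly independent frames. -/
theorem exists_uniformGrassmann_absolutelyContinuous (V : Grassmannian N r) :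
    ∃ g : (Fin r → EuclideanSpace ℝ (Fin N)) → Grassmannian N r, Measurable g ∧
      (∀ a, LinearIndependent ℝ a → (g a).1 = Submodule.span ℝ (Set.range a)) ∧
      uniformGrassmann N r ≪
        (Measure.pi fun _ : Fin r => stdGaussian (EuclideanSpace ℝ (Fin N))).map g := by
  have hemb : MeasurableEmbedding
      (Subtype.val : {a : Fin r → EuclideanSpace ℝ (Fin N) // LinearIndependent ℝ a} → _) :=
    MeasurableEmbedding.subtype_coe
      (isOpen_setOfPred_linearIndependent (𝕜 := ℝ) (E := EuclideanSpace ℝ (Fin N))).measurableSet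
  -- The extension to dependent frames takes arbitrary values; `V` only ensures that the
  -- Grassmannian is nonempty.
  obtain ⟨g, hg, hgf⟩ := hemb.exists_measurable_extend (measurable_frameSpan N r) fun _ => ⟨V⟩
  refine ⟨g, hg, fun a ha => ?_, ?_⟩
  · have : g a = frameSpan N r ⟨a, ha⟩ := congrFun hgf ⟨a, ha⟩
    rw [this]
    rfl
  -- Pulling back to independent frames and pushing forward again restricts the Gaussian law, and a
  -- restriction is dominated by the law itself.
  · rw [uniformGrassmann, ← hgf, ← Measure.map_map hg hemb.measurable, hemb.map_comap]
    exact Measure.absolutelyContinuous_of_le Measure.restrict_le_self |>.map hg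

end Measurability

/-- The rank of the projected sum of two subspaces for a generic design. -/
def genericRank {L : ℕ} (N r : ℕ) (m : Fin L → ℕ) (i j : Fin L) : ℕ :=
  min (min N (2 * r)) (min (∑ l, m l) (min (∑ l, m l + r - m i) (∑ l, m l + r - m j)))

/-- Genericity passes from Lebesgue measure on frames to Gaussian frames, then to their spans, and
by independence and absolute continuity to the joint law of the `R i`. Almost every `z` is then
good, in particular some `z` is. -/
theorem ae_exists_generic_rows {Ω : Type*} [MeasurableSpace Ω] {μ : Measure Ω}
    [IsProbabilityMeasure μ] {L N r : ℕ} {m : Fin L → ℕ} (hr : r < N)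
    (hm : ∀ l, m l + r ≤ N) {R : Fin L → Ω → Grassmannian N r} (hR : ∀ i, Measurable (R i))
    (hR_indep : iIndepFun R μ) (hR_law : ∀ i, μ.map (R i) ≪ uniformGrassmann N r) :
    ∀ᵐ ω ∂μ, ∃ z : (l : Fin L) × Fin (m l) → EuclideanSpace ℝ (Fin N), ∀ i j, i ≠ j →
      genericRank N r m i j ≤ (blockMatrix (fun l => R l ω) z *
        (projMatrix (R i ω) + projMatrix (R j ω))).rank := by
  rcases Nat.eq_zero_or_pos L with hL | hL
  · subst hL
    exact Eventually.of_forall fun ω => ⟨0, fun i => i.elim0⟩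
  obtain ⟨ω₀⟩ : Nonempty Ω := nonempty_of_isProbabilityMeasure μ
  obtain ⟨g, hg, hgspan, hgac⟩ := exists_uniformGrassmann_absolutelyContinuous (R ⟨0, hL⟩ ω₀)
  set γ : Measure (Fin r → EuclideanSpace ℝ (Fin N)) :=
    Measure.pi fun _ : Fin r => stdGaussian (EuclideanSpace ℝ (Fin N)) with hγ
  have hγac : γ ≪ volume := pi_absolutelyContinuous fun _ => stdGaussian_absolutelyContinuous N
  have hγLac : (Measure.pi fun _ : Fin L => γ) ≪ volume := pi_absolutelyContinuous fun _ => hγac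
  set Good : Set ((Fin L → Grassmannian N r) ×
      ((l : Fin L) × Fin (m l) → EuclideanSpace ℝ (Fin N))) :=
    {q | ∀ i j, i ≠ j → genericRank N r m i j ≤
      (blockMatrix q.1 q.2 * (projMatrix (q.1 i) + projMatrix (q.1 j))).rank} with hGood
  have hGoodm : MeasurableSet Good := by
    simp only [hGood, Set.ofPred_forall]
    exact MeasurableSet.iInter fun i => MeasurableSet.iInter fun j => MeasurableSet.iInter fun _ =>
      measurableSet_le_rank_blockMatrix_mul i j _
  have h1 : ∀ᵐ q ∂(Measure.pi fun _ : Fin L => γ).prod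
      (volume : Measure ((l : Fin L) × Fin (m l) → EuclideanSpace ℝ (Fin N))),
      ((fun l => g (q.1 l)), q.2) ∈ Good := by
    refine (hγLac.prod Measure.AbsolutelyContinuous.rfl).ae_le ?_
    simp only [hGood, Set.mem_ofPred_eq]
    refine ae_all_iff.2 fun i => ae_all_iff.2 fun j => ae_all_iff.2 fun hij => ?_
    have hmi : m i ≤ ∑ l, m l := Finset.single_le_sum (fun _ _ => Nat.zero_le _) (Finset.mem_univ i)
    have hmj : m j ≤ ∑ l, m l := Finset.single_le_sum (fun _ _ => Nat.zero_le _) (Finset.mem_univ j)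
    filter_upwards [ae_le_rank_blockMatrix_mul (ρ := genericRank N r m i j) hr hm hij
      (by unfold genericRank; omega) (by unfold genericRank; omega)
      (by unfold genericRank; omega) (by unfold genericRank; omega)
      (by unfold genericRank; omega)] with q hq
    exact hq.2 _ fun l => hgspan _ (hq.1 l)
  -- Fubini separates the rows from the subspaces, so that the rows may be chosen after the draw.
  have h2 : ∀ᵐ P ∂Measure.pi fun _ : Fin L => γ.map g, ∀ᵐ z, (P, z) ∈ Good := by
    have hmap : (Measure.pi fun _ : Fin L => γ).map (fun a l => g (a l)) =
        Measure.pi fun _ : Fin L => γ.map g :=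
      Measure.pi_map_pi fun _ => hg.aemeasurable
    have hgm : Measurable fun (a : Fin L → Fin r → EuclideanSpace ℝ (Fin N)) (l : Fin L) =>
        g (a l) := measurable_pi_lambda _ fun l => hg.comp (measurable_pi_apply l)
    rw [← hmap, ae_map_iff hgm.aemeasurable]
    · exact Measure.ae_ae_of_ae_prod h1
    · exact measurable_measure_prodMk_left hGoodm.compl (measurableSet_singleton 0)
  have hlaw : μ.map (fun ω l => R l ω) = Measure.pi fun l => μ.map (R l) :=
    (iIndepFun_iff_map_fun_eq_pi_map fun i => (hR i).aemeasurable).1 hR_indep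
  have : ∀ l, IsProbabilityMeasure (μ.map (R l)) := fun l =>
    Measure.isProbabilityMeasure_map (hR l).aemeasurable
  have : IsProbabilityMeasure (γ.map g) := Measure.isProbabilityMeasure_map hg.aemeasurable
  have h3 : ∀ᵐ P ∂μ.map (fun ω l => R l ω), ∀ᵐ z, (P, z) ∈ Good := by
    rw [hlaw]
    exact (pi_absolutelyContinuous fun l => (hR_law l).trans hgac).ae_le h2
  filter_upwards [ae_of_ae_map (measurable_pi_lambda _ hR).aemeasurable h3] with ω hω
  exact hω.exists


/-- The constant choice `N - r` satisfies the constraints of the integer program. -/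
theorem isFeasible_const {L N r : ℕ} (hr : r < N) {d₀ : ℝ}
    (hd₀ : d₀ < (2 * min (N - r) r : ℕ) / 4) : IsFeasible L N r d₀ fun _ => N - r := by
  refine ⟨fun i => by beta_reduce; omega, fun i j hij => ?_⟩
  have hd : 4 * d₀ < ((2 * min (N - r) r : ℕ) : ℝ) := by linarith
  have key : ∀ a : ℤ, ((2 * min (N - r) r : ℕ) : ℤ) ≤ a → (a : ℝ) > 4 * d₀ := fun a ha =>
    hd.trans_le (by exact_mod_cast ha)
  -- Whatever the total `M`, bounding the maxima by `M - r` in the first constraint and by `N - r`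
  -- in the others leaves at least `2 r` or `2 (N - r)`.
  refine ⟨key _ ?_, key _ ?_, key _ ?_, key _ ?_⟩ <;> unfold programF <;> beta_reduce <;> omega

/-- The lower bound on the sum of the ranks of a pair of classes that the constraints of the
integer program guarantee for a generic design. -/
theorem lt_of_isFeasible {L N r : ℕ} (hr : r < N) {d₀ : ℝ}
    (hd₀ : d₀ < (2 * min (N - r) r : ℕ) / 4) {m : Fin L → ℕ} (hm : IsFeasible L N r d₀ m)
    {i j : Fin L} (hij : i ≠ j) {a b c : ℕ} (ha : a ≤ r) (hb : b ≤ r)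
    (ha' : a + m i ≤ ∑ l, m l) (hb' : b + m j ≤ ∑ l, m l) (hc : genericRank N r m i j ≤ c) :
    d₀ < ((c : ℝ) - min (a : ℝ) b) / 2 := by
  obtain ⟨h1, h2, h3, h4⟩ := hm.2 i j hij
  suffices h : 4 * d₀ < ((2 * c - a - b : ℤ) : ℝ) by
    push_cast at h
    have : min (a : ℝ) b ≤ (a + b) / 2 := by
      rcases le_total (a : ℝ) b with h | h
      · rw [min_eq_left h]; linarith
      · rw [min_eq_right h]; linarith
    linarith
  have key : ∀ t : ℤ, (t : ℝ) > 4 * d₀ → t ≤ 2 * c - a - b → 4 * d₀ < ((2 * c - a - b : ℤ) : ℝ) :=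
    fun t ht hle => ht.lt.trans_le (by exact_mod_cast hle)
  -- The case where the rank is capped by `N`: then `2 c - a - b ≥ 2 (N - r)`, for which the program
  -- has no constraint.
  have h5 : (((2 * min (N - r) r : ℕ) : ℤ) : ℝ) > 4 * d₀ := by
    push_cast at hd₀ ⊢; linarith
  -- One case for each term of the minimum `genericRank`; the other four match the four constraints.
  have hcases : N ≤ c ∨ 2 * r ≤ c ∨ ∑ l, m l ≤ c ∨ ∑ l, m l + r - m i ≤ c ∨
      ∑ l, m l + r - m j ≤ c := by
    unfold genericRank at hc
    omega
  rcases hcases with h | h | h | h | h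
  · exact key _ h5 (by omega)
  · exact key _ h1 (by unfold programF; omega)
  · exact key _ h4 (by unfold programF; omega)
  · exact key _ h2 (by unfold programF; omega)
  · exact key _ h3 (by unfold programF; omega)

/-- Measurements supported on generic vectors orthogonal to the images of the covariances, in
numbers solving the integer program, attain the prescribed decay exponent. -/
theorem exists_design_decayExponentGT {L N r : ℕ} (hr : r < N) {p : Fin L → ℝ}
    (hp : ∀ i, 0 ≤ p i) {d₀ : ℝ} (hd₀ : d₀ < (2 * min (N - r) r : ℕ) / 4) {m : Fin L → ℕ}
    (hm : IsFeasible L N r d₀ m) {P : Fin L → Grassmannian N r}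
    {z : (l : Fin L) × Fin (m l) → EuclideanSpace ℝ (Fin N)}
    (hz : ∀ i j, i ≠ j → genericRank N r m i j ≤
      (blockMatrix P z * (projMatrix (P i) + projMatrix (P j))).rank)
    {S : Fin L → Matrix (Fin N) (Fin N) ℝ} (hS : ∀ i, (S i).PosSemidef)
    (hSP : ∀ i, LinearMap.range (S i).toEuclideanLin = (P i).1) :
    ∃ Φ : Matrix (Fin (∑ l, m l)) (Fin N) ℝ, DecayExponentGT p S Φ d₀ := by
  set Φ : Matrix (Fin (∑ l, m l)) (Fin N) ℝ :=
    (blockMatrix P z).submatrix finSigmaFinEquiv.symm (Equiv.refl _) with hΦ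
  have hrank : ∀ X : Matrix (Fin N) (Fin N) ℝ, (Φ * X).rank = (blockMatrix P z * X).rank := by
    intro X
    have : Φ * X = (blockMatrix P z * X).submatrix finSigmaFinEquiv.symm (Equiv.refl _) := by
      rw [← Matrix.submatrix_mul_equiv _ X _ (Equiv.refl _) _, ← hΦ]
      rfl
    rw [this, Matrix.rank_submatrix]
  have hle : ∀ i, (Φ * S i * Φ.transpose).rank ≤ r := fun i => by
    rw [rank_mul_mul_transpose Φ (hS i)]
    refine (Matrix.rank_mul_le_right _ _).trans ?_
    rw [rank_eq_finrank_range_toEuclideanLin, hSP i, (P i).2]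
  have hadd : ∀ i, (Φ * S i * Φ.transpose).rank + m i ≤ ∑ l, m l := fun i => by
    rw [rank_mul_mul_transpose Φ (hS i), hrank]
    exact rank_blockMatrix_mul_add_le P z (hSP i)
  refine ⟨Φ, decayExponentGT_of_lt_pairExponent hp hS fun i j hij => ?_⟩
  refine lt_of_isFeasible hr hd₀ hm hij (hle i) (hle j) (hadd i) (hadd j) ((hz i j hij).trans ?_)
  -- The image of `S i + S j` contains both subspaces, hence the image of the sum of projections, to
  -- which the generic bound applies.
  rw [← Matrix.add_mul, ← Matrix.mul_add, rank_mul_mul_transpose Φ ((hS i).add (hS j)), hrank]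
  refine rank_mul_le_of_range_le _ ?_
  have hsup : LinearMap.range (projMatrix (P i) + projMatrix (P j)).toEuclideanLin ≤
      (P i).1 ⊔ (P j).1 := by
    rw [map_add]
    refine (LinearMap.range_add_le _ _).trans ?_
    rw [range_projMatrix, range_projMatrix]
  refine hsup.trans (sup_le ?_ ?_)
  · rw [← hSP i]
    exact range_le_range_add (hS i) (hS j)
  · rw [← hSP j, add_comm]
    exact range_le_range_add (hS j) (hS i)

end LinearClassification

theorem proposition6
    {Ω : Type*} [MeasurableSpace Ω] (μ : Measure Ω) [IsProbabilityMeasure μ]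
    (L N r : ℕ) (hr : r < N)
    (p : Fin L → ℝ) (hp : ∀ i, 0 ≤ p i) (hp_sum : ∑ i, p i = 1)
    (R : Fin L → Ω → Grassmannian N r) (hR : ∀ i, Measurable (R i))
    (hR_indep : iIndepFun R μ) (hR_law : ∀ i, μ.map (R i) ≪ uniformGrassmann N r)
    (d₀ : ℝ) (hd₀ : d₀ < (2 * min (N - r) r : ℕ) / 4) :
    ∀ᵐ ω ∂μ, ∀ S : Fin L → Matrix (Fin N) (Fin N) ℝ,
      (∀ i, (S i).PosSemidef) →
      (∀ i, LinearMap.range (S i).toEuclideanLin = (R i ω).1) →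
      ∃ Mopt : ℕ, IsLeast (programValues L N r d₀) Mopt ∧
        ∃ Mmin : ℕ,
          IsLeast {M : ℕ | ∃ Φ : Matrix (Fin M) (Fin N) ℝ, DecayExponentGT p S Φ d₀} Mmin ∧
          Mmin ≤ Mopt := by
  classical
  -- Both minima exist by well-ordering once the sets are nonempty. The exceptional event depends
  -- only on the optimal `m`, fixed before the draw and before the covariances.
  have hex : ∃ M, M ∈ programValues L N r d₀ := ⟨_, _, isFeasible_const hr hd₀, rfl⟩
  obtain ⟨m, hm, hM⟩ := Nat.find_spec hex
  have hopt : IsLeast (programValues L N r d₀) (Nat.find hex) :=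
    ⟨Nat.find_spec hex, fun M hM => Nat.find_min' hex hM⟩
  have hmr : ∀ l, m l + r ≤ N := fun l => by have := hm.1 l; omega
  filter_upwards [ae_exists_generic_rows hr hmr hR hR_indep hR_law] with ω hω S hS hSR
  obtain ⟨z, hz⟩ := hω
  have hdes : ∃ M, ∃ Φ : Matrix (Fin M) (Fin N) ℝ, DecayExponentGT p S Φ d₀ :=
    ⟨_, exists_design_decayExponentGT hr hp hd₀ hm (P := fun l => R l ω) hz hS hSR⟩
  refine ⟨Nat.find hex, hopt, Nat.find hdes,
    ⟨Nat.find_spec hdes, fun M hM => Nat.find_min' hdes hM⟩, ?_⟩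
  rw [hM]
  exact Nat.find_min' hdes
    (exists_design_decayExponentGT hr hp hd₀ hm (P := fun l => R l ω) hz hS hSR)
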